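/- **Setting.** Let $\mathcal E,\mathcal F,\mathcal G$ be (Quillen) exact categories, i.e. additive categories with a class of kernel–cokernel pairs $X\to W\to Y$ (the short exact sequences) that is closed under isomorphism, such that identities are admissible monics and admissible epics, admissible monics (epics) are closed under composition, and push-outs of admissible monics (pull-backs of admissible epics) along arbitrary morphisms exist and are admissible monics (epics). Each is viewed as an extriangulated category with $\mathbb E(Y,X)=\operatorname{Ext}^1(Y,X)$, the group of equivalence classes $[X\to W\to Y]$ of short exact sequences under Baer sum, and with realisation the identity. *Biexact functors.* A functor $F\colon\mathcal E\times\mathcal F\to\mathcal G$ is *biexact* if $F(X,-)$ and $F(-,Y)$ send short exact sequences to short exact sequences for all $X\in\mathcal E$, $Y\in\mathcal F$. *Biextriangulated functors.* A *biextriangulated functor* $(F,\phi,\psi)\colon\mathcal E\times\mathcal F\to\mathcal G$ consists of a functor $F\colon \mathcal E\times\mathcal F\to\mathcal G$, for each $Y\in\mathcal F$ a natural transformation of functors to abelian groups $\phi^Y\colon\operatorname{Ext}^1_{\mathcal E}(-,-)\to\operatorname{Ext}^1_{\mathcal G}(F(-,Y),F(-,Y))$, and for each $X\in\mathcal E$ a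 natural transformation $\psi^X\colon\operatorname{Ext}^1_{\mathcal F}(-,-)\to\operatorname{Ext}^1_{\mathcal G}(F(X,-),F(X,-))$, such that * $(F(-,Y),\phi^Y)$ and $(F(X,-),\psi^X)$ are extriangulated functors, that is, the underlying functors are additive, and whenever $d$ is realised by $A\xrightarrow{f}W\xrightarrow{g}B$, the image of $d$ under the natural transformation is realised by the image of this sequence under the functor; * $F(X,g)_*\,\phi^Y(d)=F(X',g)^*\,\phi^{Y'}(d)$ for all $g\colon Y\to Y'$ and $d\in\operatorname{Ext}^1(X',X)$; * $F(f,Y)_*\,\psi^X(e)=F(f,Y')^*\,\psi^{X'}(e)$ for all $f\colon X\to X'$ and $e\in\operatorname{Ext}^1(Y',Y)$. A biexact functor $F$ is viewed as a biextriangulated functor by letting $\phi^Y$ and $\psi^X$ apply $F(-,Y)$ and $F(X,-)$ to short exact sequences. *Second extensions.* Fix one of the following constructions of the second extension groups $\mathbb G^2$ of $\mathcal G$ and of the cup product $\smile\colon\operatorname{Ext}^1(V,U)\times\operatorname{Ext}^1(W,V)\to\mathbb G^2(W,U)$: 1. the coend $\mathbb G^2(W,U)=\int^{V}\operatorname{Ext}^1(V,U)\otimes_{\mathbb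 Z}\operatorname{Ext}^1(W,V)$, with $d\smile e$ the class of $d\otimes e$; 2. if $\mathcal G$ has enough projectives, and short exact sequences $\omega_W=[\Omega W\to P_W\to W]$ with $P_W$ projective are chosen: $\mathbb G^2(W,U)=\operatorname{Ext}^1(\Omega W,U)$, with $d\smile e=a^*d$ for any $a\colon\Omega W\to V$ with $a_*\omega_W=e$; 3. if $\mathcal G$ has enough injectives, and short exact sequences $\omega_U=[U\to I_U\to\Sigma U]$ with $I_U$ injective are chosen: $\mathbb G^2(W,U)=\operatorname{Ext}^1(W,\Sigma U)$, with $d\smile e=c_*e$ for any $c\colon V\to\Sigma U$ with $c^*\omega_U=d$. With respect to this construction, a biextriangulated functor $(F,\phi,\psi)$ is *strong* if $$\psi^{X'}(e)\smile\phi^{Y}(d)=-\,\phi^{Y'}(d)\smile\psi^{X}(e)\quad\text{in }\mathbb G^2(F(X,Y),F(X',Y'))$$ for all $d\in\operatorname{Ext}^1_{\mathcal E}(X,X')$ and $e\in\operatorname{Ext}^1_{\mathcal F}(Y,Y')$. **Proposition.** Every biexact functor $F\colon\mathcal E\times\mathcal F\to\mathcal G$, viewed as a biextriangulated functor, is strong.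 Moreover, sending a biexact functor to the associated biextriangulated functor is a bijection from the biexact functors $\mathcal E\times\mathcal F\to\mathcal G$ to the strong biextriangulated functors $\mathcal E\times\mathcal F\to\mathcal G$. -/

import Mathlib

open CategoryTheory CategoryTheory.Limits
open scoped TensorProduct

universe w v u v₁ u₁ v₂ u₂ v₃ u₃

namespace Extri

/-! ### Three-term sequences and extriangulated categories -/

section ThreeTerm

variable {C : Type u} [Category.{v} C]

/-- A sequence of two composable morphisms `X ⟶ mid ⟶ Y` with prescribed ends. -/
structure ThreeTerm (X Y : C) where
  mid : C
  f : X ⟶ mid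
  g : mid ⟶ Y

/-- Two sequences with the same ends are equivalent if there is an isomorphism of their middle
terms that is compatible with the identities of the ends. -/
def ThreeTerm.Equiv {X Y : C} (S T : ThreeTerm X Y) : Prop :=
  ∃ e : S.mid ≅ T.mid, S.f ≫ e.hom = T.f ∧ e.hom ≫ T.g = S.g

instance ThreeTerm.setoid (X Y : C) : Setoid (ThreeTerm X Y) where
  r := ThreeTerm.Equiv
  iseqv :=
    { refl := fun S => ⟨Iso.refl _, by simp, by simp⟩
      symm := by
        rintro S T ⟨e, h₁, h₂⟩
        exact ⟨e.symm, by simp [← h₁], by simp [← h₂]⟩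
      trans := by
        rintro S T U ⟨e, h₁, h₂⟩ ⟨e', h₁', h₂'⟩
        exact ⟨e ≪≫ e', by simp [reassoc_of% h₁, h₁'], by simp [h₂', h₂]⟩ }

/-- Equivalence classes `[X ⟶ W ⟶ Y]` of three-term sequences. -/
def SeqClass (X Y : C) : Type (max u v) := Quotient (ThreeTerm.setoid X Y)

/-- The equivalence class `[X ⟶ W ⟶ Y]`. -/
def SeqClass.mk {X W Y : C} (f : X ⟶ W) (g : W ⟶ Y) : SeqClass X Y :=
  Quotient.mk (ThreeTerm.setoid X Y) ⟨W, f, g⟩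

lemma SeqClass.mk_eq_mk_iff {X W W' Y : C} {f : X ⟶ W} {g : W ⟶ Y} {f' : X ⟶ W'} {g' : W' ⟶ Y} :
    SeqClass.mk f g = SeqClass.mk f' g' ↔
      ∃ e : W ≅ W', f ≫ e.hom = f' ∧ e.hom ≫ g' = g :=
  ⟨fun h => Quotient.exact h, fun h => Quotient.sound h⟩

lemma SeqClass.exists_rep {X Y : C} (c : SeqClass X Y) :
    ∃ (W : C) (f : X ⟶ W) (g : W ⟶ Y), c = SeqClass.mk f g := by
  obtain ⟨⟨W, f, g⟩⟩ := c
  exact ⟨W, f, g, rfl⟩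

end ThreeTerm

/-- An extriangulated structure on an additive category `C` in the sense of Nakaoka and Palu.
`E Y X` is the group of extensions of `Y` by `X`; it is functorial in `X` through `push`
(written `a_*`) and in `Y` through `pull` (written `c^*`), and it is additive in both variables.
`s` is the realisation; that `f ≫ g = 0` for a realisation `X ⟶ W ⟶ Y` follows from the axioms. -/
structure ExtriangulatedStructure (C : Type u) [Category.{v} C] [Preadditive C] [HasZeroObject C]
    [HasBinaryBiproducts C] where
  /-- The biadditive functor `Cᵒᵖ × C → Ab`. -/
  E : C → C → Type w
  [addCommGroup : ∀ Y X, AddCommGroup (E Y X)]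
  push : ∀ {Y X X' : C}, (X ⟶ X') → (E Y X →+ E Y X')
  pull : ∀ {Y Y' X : C}, (Y' ⟶ Y) → (E Y X →+ E Y' X)
  push_id : ∀ {Y X : C} (d : E Y X), push (𝟙 X) d = d
  push_comp : ∀ {Y X X' X'' : C} (a : X ⟶ X') (a' : X' ⟶ X'') (d : E Y X),
    push (a ≫ a') d = push a' (push a d)
  pull_id : ∀ {Y X : C} (d : E Y X), pull (𝟙 Y) d = d
  pull_comp : ∀ {Y Y' Y'' X : C} (c : Y' ⟶ Y) (c' : Y'' ⟶ Y') (d : E Y X),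
    pull (c' ≫ c) d = pull c' (pull c d)
  push_pull : ∀ {Y Y' X X' : C} (a : X ⟶ X') (c : Y' ⟶ Y) (d : E Y X),
    push a (pull c d) = pull c (push a d)
  push_add : ∀ {Y X X' : C} (a a' : X ⟶ X') (d : E Y X), push (a + a') d = push a d + push a' d
  pull_add : ∀ {Y Y' X : C} (c c' : Y' ⟶ Y) (d : E Y X), pull (c + c') d = pull c d + pull c' d
  /-- The realisation. -/
  s : ∀ {Y X : C}, E Y X → SeqClass X Y
  /-- Every morphism of extensions is realised by a morphism of sequences. -/
  realize : ∀ {X W Y X' W' Y' : C} {f : X ⟶ W} {g : W ⟶ Y} {f' : X' ⟶ W'} {g' : W' ⟶ Y'}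
    {d : E Y X} {d' : E Y' X'}, s d = SeqClass.mk f g → s d' = SeqClass.mk f' g' →
    ∀ (a : X ⟶ X') (c : Y ⟶ Y'), push a d = pull c d' →
      ∃ b : W ⟶ W', f ≫ b = a ≫ f' ∧ g ≫ c = b ≫ g'
  /-- The zero element is realised by the split sequence. -/
  s_zero : ∀ Y X : C,
    s (0 : E Y X) = SeqClass.mk (biprod.inl : X ⟶ X ⊞ Y) (biprod.snd : X ⊞ Y ⟶ Y)
  /-- The direct sum of two extensions is realised by the direct sum of the sequences. -/
  s_biprod : ∀ {X W Y X' W' Y' : C} {f : X ⟶ W} {g : W ⟶ Y} {f' : X' ⟶ W'} {g' : W' ⟶ Y'}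
    {d : E Y X} {d' : E Y' X'}, s d = SeqClass.mk f g → s d' = SeqClass.mk f' g' →
    s (push biprod.inl (pull biprod.fst d) + push biprod.inr (pull biprod.snd d') :
        E (Y ⊞ Y') (X ⊞ X')) =
      SeqClass.mk (biprod.map f f') (biprod.map g g')
  /-- (ET3) -/
  et3 : ∀ {X W Y X' W' Y' : C} {f : X ⟶ W} {g : W ⟶ Y} {f' : X' ⟶ W'} {g' : W' ⟶ Y'}
    {d : E Y X} {d' : E Y' X'}, s d = SeqClass.mk f g → s d' = SeqClass.mk f' g' →
    ∀ (a : X ⟶ X') (b : W ⟶ W'), f ≫ b = a ≫ f' →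
      ∃ c : Y ⟶ Y', g ≫ c = b ≫ g' ∧ push a d = pull c d'
  /-- (ET3)ᵒᵖ -/
  et3_op : ∀ {X W Y X' W' Y' : C} {f : X ⟶ W} {g : W ⟶ Y} {f' : X' ⟶ W'} {g' : W' ⟶ Y'}
    {d : E Y X} {d' : E Y' X'}, s d = SeqClass.mk f g → s d' = SeqClass.mk f' g' →
    ∀ (b : W ⟶ W') (c : Y ⟶ Y'), g ≫ c = b ≫ g' →
      ∃ a : X ⟶ X', f ≫ b = a ≫ f' ∧ push a d = pull c d'
  /-- (ET4) -/
  et4 : ∀ {A B D C' F : C} {f : A ⟶ B} {f' : B ⟶ D} {g : B ⟶ C'} {g' : C' ⟶ F}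
    {d : E D A} {d' : E F B}, s d = SeqClass.mk f f' → s d' = SeqClass.mk g g' →
    ∃ (G : C) (h' : C' ⟶ G) (k : D ⟶ G) (l : G ⟶ F) (d'' : E G A),
      f' ≫ k = g ≫ h' ∧ h' ≫ l = g' ∧
      s d'' = SeqClass.mk (f ≫ g) h' ∧
      s (push f' d') = SeqClass.mk k l ∧ pull k d'' = d ∧ push f d'' = pull l d'
  /-- (ET4)ᵒᵖ -/
  et4_op : ∀ {D A B F C' : C} {f' : D ⟶ A} {f : A ⟶ B} {g' : F ⟶ B} {g : B ⟶ C'}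
    {d : E B D} {d' : E C' F}, s d = SeqClass.mk f' f → s d' = SeqClass.mk g' g →
    ∃ (G : C) (h' : G ⟶ A) (k : D ⟶ G) (l : G ⟶ F) (d'' : E C' G),
      h' ≫ f = l ≫ g' ∧ k ≫ h' = f' ∧
      s d'' = SeqClass.mk h' (f ≫ g) ∧
      s (pull g' d) = SeqClass.mk k l ∧ push l d'' = d' ∧ push k d = pull g d''

attribute [instance] ExtriangulatedStructure.addCommGroup

/-! ### Exact categories -/

/-- A Quillen exact structure on an additive category: a class of kernel-cokernel pairs
(the short exact sequences, or conflations) that is closed under isomorphisms, such that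
identities are admissible monics and epics, admissible monics (epics) are closed under
composition, and push-outs of admissible monics (pull-backs of admissible epics) along arbitrary
morphisms exist and are admissible monics (epics). -/
structure ExactStructure (C : Type u) [Category.{v} C] [Preadditive C] [HasZeroObject C]
    [HasBinaryBiproducts C] where
  IsConflation : ∀ {X W Y : C}, (X ⟶ W) → (W ⟶ Y) → Prop
  comp_eq_zero : ∀ {X W Y : C} {f : X ⟶ W} {g : W ⟶ Y}, IsConflation f g → f ≫ g = 0
  isKernel : ∀ {X W Y : C} {f : X ⟶ W} {g : W ⟶ Y} (h : IsConflation f g),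
    Nonempty (IsLimit (KernelFork.ofι f (comp_eq_zero h)))
  isCokernel : ∀ {X W Y : C} {f : X ⟶ W} {g : W ⟶ Y} (h : IsConflation f g),
    Nonempty (IsColimit (CokernelCofork.ofπ g (comp_eq_zero h)))
  of_iso : ∀ {X W Y X' W' Y' : C} {f : X ⟶ W} {g : W ⟶ Y} {f' : X' ⟶ W'} {g' : W' ⟶ Y'},
    IsConflation f g → ∀ (eX : X ≅ X') (eW : W ≅ W') (eY : Y ≅ Y'),
      f ≫ eW.hom = eX.hom ≫ f' → g ≫ eY.hom = eW.hom ≫ g' → IsConflation f' g'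
  id_inflation : ∀ X : C, ∃ (Y : C) (g : X ⟶ Y), IsConflation (𝟙 X) g
  id_deflation : ∀ Y : C, ∃ (X : C) (f : X ⟶ Y), IsConflation f (𝟙 Y)
  comp_inflation : ∀ {X W V : C} {f : X ⟶ W} {f' : W ⟶ V},
    (∃ (Y : C) (g : W ⟶ Y), IsConflation f g) → (∃ (Y : C) (g : V ⟶ Y), IsConflation f' g) →
      ∃ (Y : C) (g : V ⟶ Y), IsConflation (f ≫ f') g
  comp_deflation : ∀ {V W Y : C} {g : V ⟶ W} {g' : W ⟶ Y},
    (∃ (X : C) (f : X ⟶ V), IsConflation f g) → (∃ (X : C) (f : X ⟶ W), IsConflation f g') →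
      ∃ (X : C) (f : X ⟶ V), IsConflation f (g ≫ g')
  pushout_inflation : ∀ {X W X' : C} {f : X ⟶ W},
    (∃ (Y : C) (g : W ⟶ Y), IsConflation f g) → ∀ a : X ⟶ X',
      ∃ (W' : C) (b : W ⟶ W') (f' : X' ⟶ W'), IsPushout f a b f' ∧
        ∃ (Y' : C) (g' : W' ⟶ Y'), IsConflation f' g'
  pullback_deflation : ∀ {W Y Y' : C} {g : W ⟶ Y},
    (∃ (X : C) (f : X ⟶ W), IsConflation f g) → ∀ c : Y' ⟶ Y,
      ∃ (W' : C) (b : W' ⟶ W) (g' : W' ⟶ Y'), IsPullback b g' g c ∧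
        ∃ (X' : C) (f' : X' ⟶ W'), IsConflation f' g'

namespace ExactStructure

variable {C : Type u} [Category.{v} C] [Preadditive C] [HasZeroObject C] [HasBinaryBiproducts C]
  (𝓔 : ExactStructure C)

section Basic

variable {𝓔} {X W Y X' W' Y' : C} {f : X ⟶ W} {g : W ⟶ Y} {f' : X' ⟶ W'} {g' : W' ⟶ Y'}

lemma mono (h : 𝓔.IsConflation f g) : Mono f := by
  obtain ⟨i⟩ := 𝓔.isKernel h
  exact mono_of_isLimit_fork i

lemma epi (h : 𝓔.IsConflation f g) : Epi g := by
  obtain ⟨i⟩ := 𝓔.isCokernel h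
  exact Cofork.IsColimit.epi i

lemma lift (h : 𝓔.IsConflation f g) {Z : C} (k : Z ⟶ W) (hk : k ≫ g = 0) :
    ∃ l : Z ⟶ X, l ≫ f = k := by
  obtain ⟨i⟩ := 𝓔.isKernel h
  obtain ⟨l, hl⟩ := KernelFork.IsLimit.lift' i k hk
  exact ⟨l, hl⟩

lemma desc (h : 𝓔.IsConflation f g) {Z : C} (k : W ⟶ Z) (hk : f ≫ k = 0) :
    ∃ l : Y ⟶ Z, g ≫ l = k := by
  obtain ⟨i⟩ := 𝓔.isCokernel h
  obtain ⟨l, hl⟩ := CokernelCofork.IsColimit.desc' i k hk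
  exact ⟨l, hl⟩

/-- An inflation together with any cokernel is a conflation. -/
lemma of_cokernel (hf : ∃ (Z : C) (q : W ⟶ Z), 𝓔.IsConflation f q) (w : f ≫ g = 0) [Epi g]
    (hd : ∀ {Z : C} (k : W ⟶ Z), f ≫ k = 0 → ∃ l : Y ⟶ Z, g ≫ l = k) : 𝓔.IsConflation f g := by
  obtain ⟨Z, q, hq⟩ := hf
  obtain ⟨l, hl⟩ := hd q (𝓔.comp_eq_zero hq)
  obtain ⟨m, hm⟩ := desc hq g w
  have := epi hq
  exact 𝓔.of_iso hq (Iso.refl _) (Iso.refl _)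
    ⟨m, l, by rw [← cancel_epi q, reassoc_of% hm, hl, Category.comp_id],
      by rw [← cancel_epi g, reassoc_of% hl, hm, Category.comp_id]⟩ (by simp) (by simp [hm])

/-- A deflation together with any kernel is a conflation. -/
lemma of_kernel (hg : ∃ (Z : C) (j : Z ⟶ W), 𝓔.IsConflation j g) (w : f ≫ g = 0) [Mono f]
    (hl : ∀ {Z : C} (k : Z ⟶ W), k ≫ g = 0 → ∃ l : Z ⟶ X, l ≫ f = k) : 𝓔.IsConflation f g := by
  obtain ⟨Z, j, hj⟩ := hg
  obtain ⟨l, hl⟩ := hl j (𝓔.comp_eq_zero hj)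
  obtain ⟨m, hm⟩ := lift hj f w
  have := mono hj
  exact 𝓔.of_iso hj
    ⟨l, m, by rw [← cancel_mono j, Category.assoc, hm, hl, Category.id_comp],
      by rw [← cancel_mono f, Category.assoc, hl, hm, Category.id_comp]⟩
    (Iso.refl _) (Iso.refl _) (by simp [hl]) (by simp)

/-- The push-out of a conflation. -/
lemma exists_push (h : 𝓔.IsConflation f g) (a : X ⟶ X') :
    ∃ (W' : C) (b : W ⟶ W') (f' : X' ⟶ W') (g' : W' ⟶ Y), IsPushout f a b f' ∧
      𝓔.IsConflation f' g' ∧ b ≫ g' = g := by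
  obtain ⟨W', b, f', hp, hf'⟩ := 𝓔.pushout_inflation ⟨_, g, h⟩ a
  have hw : f ≫ g = a ≫ (0 : X' ⟶ Y) := by rw [𝓔.comp_eq_zero h, comp_zero]
  have := epi h
  have hb : b ≫ hp.desc g 0 hw = g := hp.inl_desc _ _ _
  have : Epi (hp.desc g 0 hw) := by
    have : Epi (b ≫ hp.desc g 0 hw) := by rw [hb]; infer_instance
    exact epi_of_epi b _
  refine ⟨W', b, f', hp.desc g 0 hw, hp, of_cokernel hf' (hp.inr_desc _ _ _) ?_, hb⟩
  intro Z k hk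
  obtain ⟨l, hl⟩ := desc h (b ≫ k) (by rw [reassoc_of% hp.w, hk, comp_zero])
  refine ⟨l, hp.hom_ext ?_ ?_⟩
  · rw [reassoc_of% hb, hl]
  · rw [hp.inr_desc_assoc, zero_comp, hk]

/-- The pull-back of a conflation. -/
lemma exists_pull (h : 𝓔.IsConflation f g) (c : Y' ⟶ Y) :
    ∃ (W' : C) (b : W' ⟶ W) (f' : X ⟶ W') (g' : W' ⟶ Y'), IsPullback b g' g c ∧
      𝓔.IsConflation f' g' ∧ f' ≫ b = f := by
  obtain ⟨W', b, g', hp, hg'⟩ := 𝓔.pullback_deflation ⟨_, f, h⟩ c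
  have hw : f ≫ g = (0 : X ⟶ Y') ≫ c := by rw [𝓔.comp_eq_zero h, zero_comp]
  have := mono h
  have hb : hp.lift f 0 hw ≫ b = f := hp.lift_fst _ _ _
  have : Mono (hp.lift f 0 hw) := by
    have : Mono (hp.lift f 0 hw ≫ b) := by rw [hb]; infer_instance
    exact mono_of_mono _ b
  refine ⟨W', b, hp.lift f 0 hw, g', hp, of_kernel hg' (hp.lift_snd _ _ _) ?_, hb⟩
  intro Z k hk
  obtain ⟨l, hl⟩ := lift h (k ≫ b) (by rw [Category.assoc, hp.w, reassoc_of% hk, zero_comp])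
  refine ⟨l, hp.hom_ext ?_ ?_⟩
  · rw [Category.assoc, hb, hl]
  · rw [Category.assoc, hp.lift_snd, comp_zero, hk]

/-- A morphism of conflations that is the identity on both ends is an isomorphism. -/
lemma exists_inverse {W' : C} {f' : X ⟶ W'} {g' : W' ⟶ Y} (h : 𝓔.IsConflation f g)
    (h' : 𝓔.IsConflation f' g') (t : W ⟶ W') (h₁ : f ≫ t = f') (h₂ : t ≫ g' = g) :
    ∃ e : W ≅ W', e.hom = t := by
  obtain ⟨P, π₁, π₂, hp⟩ : ∃ (P : C) (π₁ : P ⟶ W) (π₂ : P ⟶ W'), IsPullback π₁ π₂ g g' ∧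
      ∃ j : X ⟶ P, 𝓔.IsConflation j π₂ ∧ j ≫ π₁ = f := by
    obtain ⟨P, b, j, g₁, hp, hj, hb⟩ := exists_pull h g'
    exact ⟨P, b, g₁, hp, j, hj, hb⟩
  obtain ⟨hp, j, hj, hjf⟩ := hp
  obtain ⟨δ, hδ⟩ := lift h' (π₁ ≫ t - π₂) (by
    rw [Preadditive.sub_comp, Category.assoc, h₂, hp.w, sub_self])
  have := epi hj
  have := mono h'
  have hjδ : j ≫ δ = 𝟙 X := by
    rw [← cancel_mono f', Category.assoc, hδ, Preadditive.comp_sub, 𝓔.comp_eq_zero hj, sub_zero,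
      reassoc_of% hjf, h₁, Category.id_comp]
  obtain ⟨s, hs⟩ := desc hj (π₁ - δ ≫ f) (by
    rw [Preadditive.comp_sub, hjf, reassoc_of% hjδ, sub_self])
  have hst : s ≫ t = 𝟙 W' := by
    rw [← cancel_epi π₂, reassoc_of% hs, Preadditive.sub_comp, Category.assoc, h₁, hδ,
      sub_sub_cancel, Category.comp_id]
  have hσ₁ := hp.lift_fst (𝟙 W) t (by rw [Category.id_comp, h₂])
  have hσ₂ := hp.lift_snd (𝟙 W) t (by rw [Category.id_comp, h₂])
  set σ := hp.lift (𝟙 W) t (by rw [Category.id_comp, h₂])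
  have hσδ : σ ≫ δ = 0 := by
    rw [← cancel_mono f', Category.assoc, hδ, Preadditive.comp_sub, reassoc_of% hσ₁, hσ₂,
      sub_self, zero_comp]
  have hts : t ≫ s = 𝟙 W := by
    rw [← hσ₂, Category.assoc, hs, Preadditive.comp_sub, hσ₁, reassoc_of% hσδ, zero_comp, sub_zero]
  exact ⟨⟨t, s, hts, hst⟩, rfl⟩

/-- The split sequence is a conflation. -/
lemma split_conflation (𝓔 : ExactStructure C) (X Y : C) :
    𝓔.IsConflation (biprod.inl : X ⟶ X ⊞ Y) (biprod.snd : X ⊞ Y ⟶ Y) := by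
  obtain ⟨Z, f, hf⟩ := 𝓔.id_deflation Y
  have hf0 : f = 0 := by simpa using 𝓔.comp_eq_zero hf
  obtain ⟨P, b, f', g', hp, h', hb⟩ := exists_push hf (0 : Z ⟶ X)
  have hw : f ≫ (biprod.inr : Y ⟶ X ⊞ Y) = (0 : Z ⟶ X) ≫ biprod.inl := by simp [hf0]
  refine 𝓔.of_iso h' (Iso.refl _)
    ⟨hp.desc biprod.inr biprod.inl hw, biprod.desc f' b, ?_, ?_⟩ (Iso.refl _) ?_ ?_
  · apply hp.hom_ext <;> simp
  · ext <;> simp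
  · simp
  · apply hp.hom_ext <;> simp [hb, 𝓔.comp_eq_zero h']

/-- The direct sum of two conflations is a conflation. -/
lemma biprod_conflation (h : 𝓔.IsConflation f g) (h' : 𝓔.IsConflation f' g') :
    𝓔.IsConflation (biprod.map f f') (biprod.map g g') := by
  have key : ∀ {X W Y : C} {f : X ⟶ W} {g : W ⟶ Y} (Z : C), 𝓔.IsConflation f g →
      ∃ (V : C) (q : W ⊞ Z ⟶ V), 𝓔.IsConflation (biprod.map f (𝟙 Z)) q := by
    intro X W Y f g Z h
    obtain ⟨P, b, f', g', hp, hc, hb⟩ := exists_push h (biprod.inl : X ⟶ X ⊞ Z)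
    have hw : f ≫ (biprod.inl : W ⟶ W ⊞ Z) = biprod.inl ≫ biprod.map f (𝟙 Z) := by simp
    refine ⟨Y, biprod.desc b (biprod.inr ≫ f') ≫ g', 𝓔.of_iso hc (Iso.refl _)
      ⟨hp.desc biprod.inl (biprod.map f (𝟙 Z)) hw, biprod.desc b (biprod.inr ≫ f'), ?_, ?_⟩
      (Iso.refl _) ?_ ?_⟩
    · apply hp.hom_ext
      · simp
      · ext
        · simp [← hp.w]
        · simp
    · ext <;> simp
    · simp
    · apply hp.hom_ext
      · simp
      · ext
        · simp [← reassoc_of% hp.w]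
        · simp
  have key' : ∀ {X W Y : C} {f : X ⟶ W} {g : W ⟶ Y} (Z : C), 𝓔.IsConflation f g →
      ∃ (V : C) (q : Z ⊞ W ⟶ V), 𝓔.IsConflation (biprod.map (𝟙 Z) f) q := by
    intro X W Y f g Z h
    obtain ⟨V, q, hq⟩ := key Z h
    refine ⟨V, (biprod.braiding _ _).hom ≫ q, 𝓔.of_iso hq (biprod.braiding _ _)
      (biprod.braiding _ _) (Iso.refl _) ?_ ?_⟩
    · ext <;> simp
    · simp
  have hi : ∃ (V : C) (q : W ⊞ W' ⟶ V), 𝓔.IsConflation (biprod.map f f') q := by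
    have := 𝓔.comp_inflation (key X' h) (key' W h')
    have e : biprod.map f (𝟙 X') ≫ biprod.map (𝟙 W) f' = biprod.map f f' := by
      ext <;> simp
    rwa [e] at this
  have := epi h
  have := epi h'
  refine @of_cokernel _ _ _ _ _ _ _ _ _ _ _ hi ?_ ?_ ?_
  · ext <;> simp [𝓔.comp_eq_zero h, 𝓔.comp_eq_zero h']
  · infer_instance
  · intro Z k hk
    obtain ⟨l, hl⟩ := desc h (biprod.inl ≫ k) (by
      have := (biprod.inl : X ⟶ X ⊞ X') ≫= hk; simpa using this)
    obtain ⟨l', hl'⟩ := desc h' (biprod.inr ≫ k) (by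
      have := (biprod.inr : X' ⟶ X ⊞ X') ≫= hk; simpa using this)
    exact ⟨biprod.desc l l', by ext <;> simp [hl, hl']⟩

end Basic

/-! ### The groups `Ext¹` of an exact category -/

/-- A short exact sequence `X ⟶ mid ⟶ Y`. -/
structure Extension (Y X : C) extends ThreeTerm X Y where
  conf : 𝓔.IsConflation f g

instance Extension.setoid (Y X : C) : Setoid (𝓔.Extension Y X) :=
  (ThreeTerm.setoid X Y).comap Extension.toThreeTerm

/-- `Ext¹(Y, X)`: the equivalence classes of short exact sequences `X ⟶ W ⟶ Y`. -/
def Ext1 (Y X : C) : Type (max u v) := Quotient (Extension.setoid 𝓔 Y X)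

variable {𝓔}

/-- The class in `Ext¹(Y, X)` of a short exact sequence `X ⟶ W ⟶ Y`. -/
def Ext1.mk {X W Y : C} {f : X ⟶ W} {g : W ⟶ Y} (h : 𝓔.IsConflation f g) : 𝓔.Ext1 Y X :=
  Quotient.mk (Extension.setoid 𝓔 Y X) ⟨⟨W, f, g⟩, h⟩

namespace Ext1

variable {X W Y X' W' Y' : C} {f : X ⟶ W} {g : W ⟶ Y} {f' : X' ⟶ W'} {g' : W' ⟶ Y'}

lemma ind {p : 𝓔.Ext1 Y X → Prop}
    (h : ∀ {W : C} {f : X ⟶ W} {g : W ⟶ Y} (h : 𝓔.IsConflation f g), p (mk h)) (d) : p d := by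
  obtain ⟨⟨⟨W, f, g⟩, hh⟩⟩ := d
  exact h hh

lemma mk_eq_of_morphism {W' : C} {f' : X ⟶ W'} {g' : W' ⟶ Y} (h : 𝓔.IsConflation f g)
    (h' : 𝓔.IsConflation f' g') (t : W ⟶ W') (h₁ : f ≫ t = f') (h₂ : t ≫ g' = g) :
    mk h = mk h' := by
  obtain ⟨e, rfl⟩ := exists_inverse h h' t h₁ h₂
  exact Quotient.sound ⟨e, h₁, h₂⟩

lemma exists_iso_of_mk_eq {W' : C} {f' : X ⟶ W'} {g' : W' ⟶ Y} {h : 𝓔.IsConflation f g}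
    {h' : 𝓔.IsConflation f' g'} (e : mk h = mk h') :
    ∃ t : W ≅ W', f ≫ t.hom = f' ∧ t.hom ≫ g' = g :=
  Quotient.exact e

lemma exists_push' (a : X ⟶ X') (S : 𝓔.Extension Y X) :
    ∃ (T : 𝓔.Extension Y X') (b : S.mid ⟶ T.mid), IsPushout S.f a b T.f ∧ b ≫ T.g = S.g := by
  obtain ⟨W', b, f', g', hp, h', hb⟩ := exists_push S.conf a
  exact ⟨⟨⟨W', f', g'⟩, h'⟩, b, hp, hb⟩

lemma exists_pull' (c : Y' ⟶ Y) (S : 𝓔.Extension Y X) :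
    ∃ (T : 𝓔.Extension Y' X) (b : T.mid ⟶ S.mid), IsPullback b T.g S.g c ∧ T.f ≫ b = S.f := by
  obtain ⟨W', b, f', g', hp, h', hb⟩ := exists_pull S.conf c
  exact ⟨⟨⟨W', f', g'⟩, h'⟩, b, hp, hb⟩

lemma push_unique (a : X ⟶ X') {S : 𝓔.Extension Y X} {T T' : 𝓔.Extension Y X'}
    {b : S.mid ⟶ T.mid} (hp : IsPushout S.f a b T.f) (hb : b ≫ T.g = S.g)
    {b' : S.mid ⟶ T'.mid} (h₁ : S.f ≫ b' = a ≫ T'.f) (h₂ : b' ≫ T'.g = S.g) :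
    mk T.conf = mk T'.conf :=
  mk_eq_of_morphism _ _ (hp.desc b' T'.f h₁) (hp.inr_desc _ _ _) (hp.hom_ext
    (by rw [hp.inl_desc_assoc, h₂, hb])
    (by rw [hp.inr_desc_assoc, 𝓔.comp_eq_zero T.conf, 𝓔.comp_eq_zero T'.conf]))

lemma pull_unique (c : Y' ⟶ Y) {S : 𝓔.Extension Y X} {T T' : 𝓔.Extension Y' X}
    {b : T.mid ⟶ S.mid} (hp : IsPullback b T.g S.g c) (hb : T.f ≫ b = S.f)
    {b' : T'.mid ⟶ S.mid} (h₁ : b' ≫ S.g = T'.g ≫ c) (h₂ : T'.f ≫ b' = S.f) :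
    mk T'.conf = mk T.conf :=
  mk_eq_of_morphism _ _ (hp.lift b' T'.g h₁) (hp.hom_ext
    (by rw [Category.assoc, hp.lift_fst, h₂, hb])
    (by rw [Category.assoc, hp.lift_snd, 𝓔.comp_eq_zero T.conf, 𝓔.comp_eq_zero T'.conf]))
    (hp.lift_snd _ _ _)

/-- `a_* : Ext¹(Y, X) → Ext¹(Y, X')`, given by the push-out of short exact sequences. -/
noncomputable def push (a : X ⟶ X') : 𝓔.Ext1 Y X → 𝓔.Ext1 Y X' :=
  Quotient.lift (fun S => mk (exists_push' a S).choose.conf) (by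
    rintro S S' ⟨e, h₁, h₂⟩
    obtain ⟨b, hp, hb⟩ := (exists_push' a S).choose_spec
    obtain ⟨b', hp', hb'⟩ := (exists_push' a S').choose_spec
    exact push_unique a hp hb (b' := e.hom ≫ b') (by rw [reassoc_of% h₁, hp'.w])
      (by rw [Category.assoc, hb', h₂]))

/-- `c^* : Ext¹(Y, X) → Ext¹(Y', X)`, given by the pull-back of short exact sequences. -/
noncomputable def pull (c : Y' ⟶ Y) : 𝓔.Ext1 Y X → 𝓔.Ext1 Y' X :=
  Quotient.lift (fun S => mk (exists_pull' c S).choose.conf) (by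
    rintro S S' ⟨e, h₁, h₂⟩
    obtain ⟨b, hp, hb⟩ := (exists_pull' c S).choose_spec
    obtain ⟨b', hp', hb'⟩ := (exists_pull' c S').choose_spec
    exact pull_unique c hp' hb' (b' := b ≫ e.hom) (by rw [Category.assoc, h₂, hp.w])
      (by rw [reassoc_of% hb, h₁]))

lemma push_mk (h : 𝓔.IsConflation f g) {W' : C} {f' : X' ⟶ W'} {g' : W' ⟶ Y}
    (h' : 𝓔.IsConflation f' g') (a : X ⟶ X') (b : W ⟶ W') (h₁ : f ≫ b = a ≫ f')
    (h₂ : b ≫ g' = g) : push a (mk h) = mk h' := by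
  obtain ⟨b₀, hp, hb⟩ := (exists_push' a ⟨⟨W, f, g⟩, h⟩).choose_spec
  exact push_unique a (T' := ⟨⟨W', f', g'⟩, h'⟩) hp hb h₁ h₂

lemma pull_mk {W' : C} {f' : X ⟶ W'} {g' : W' ⟶ Y'} (h : 𝓔.IsConflation f g)
    (h' : 𝓔.IsConflation f' g') (c : Y' ⟶ Y) (b : W' ⟶ W) (h₁ : b ≫ g = g' ≫ c)
    (h₂ : f' ≫ b = f) : pull c (mk h) = mk h' := by
  obtain ⟨b₀, hp, hb⟩ := (exists_pull' c ⟨⟨W, f, g⟩, h⟩).choose_spec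
  exact (pull_unique c (T' := ⟨⟨W', f', g'⟩, h'⟩) hp hb h₁ h₂).symm

/-- Morphisms of short exact sequences and morphisms of extensions agree. -/
lemma push_eq_pull_iff (h : 𝓔.IsConflation f g) (h' : 𝓔.IsConflation f' g') (a : X ⟶ X')
    (c : Y ⟶ Y') :
    push a (mk h) = pull c (mk h') ↔ ∃ b : W ⟶ W', f ≫ b = a ≫ f' ∧ g ≫ c = b ≫ g' := by
  constructor
  · intro e
    obtain ⟨U, b₁, f₁, g₁, hp, hc₁, hb₁⟩ := exists_push h a
    obtain ⟨V, b₂, f₂, g₂, hp', hc₂, hb₂⟩ := exists_pull h' c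
    rw [push_mk h hc₁ a b₁ hp.w hb₁, pull_mk h' hc₂ c b₂ hp'.w hb₂] at e
    obtain ⟨t, ht₁, ht₂⟩ := exists_iso_of_mk_eq e
    refine ⟨b₁ ≫ t.hom ≫ b₂, ?_, ?_⟩
    · rw [reassoc_of% hp.w, reassoc_of% ht₁, hb₂]
    · rw [Category.assoc, Category.assoc, hp'.w, reassoc_of% ht₂, reassoc_of% hb₁]
  · rintro ⟨b, hb₁, hb₂⟩
    obtain ⟨U, b₁, f₁, g₁, hp, hc₁, hb⟩ := exists_push h a
    rw [push_mk h hc₁ a b₁ hp.w hb]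
    symm
    refine pull_mk h' hc₁ c (hp.desc b f' hb₁) (hp.hom_ext ?_ ?_) (hp.inr_desc _ _ _)
    · rw [hp.inl_desc_assoc, ← hb₂, reassoc_of% hb]
    · rw [hp.inr_desc_assoc, 𝓔.comp_eq_zero h', reassoc_of% (𝓔.comp_eq_zero hc₁), zero_comp]

lemma exists_push_mk (h : 𝓔.IsConflation f g) (a : X ⟶ X') :
    ∃ (W' : C) (b : W ⟶ W') (f' : X' ⟶ W') (g' : W' ⟶ Y) (h' : 𝓔.IsConflation f' g'),
      f ≫ b = a ≫ f' ∧ b ≫ g' = g ∧ push a (mk h) = mk h' := by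
  obtain ⟨U, b₁, f₁, g₁, hp, hc₁, hb⟩ := exists_push h a
  exact ⟨U, b₁, f₁, g₁, hc₁, hp.w, hb, push_mk h hc₁ a b₁ hp.w hb⟩

lemma exists_pull_mk (h : 𝓔.IsConflation f g) (c : Y' ⟶ Y) :
    ∃ (W' : C) (b : W' ⟶ W) (f' : X ⟶ W') (g' : W' ⟶ Y') (h' : 𝓔.IsConflation f' g'),
      b ≫ g = g' ≫ c ∧ f' ≫ b = f ∧ pull c (mk h) = mk h' := by
  obtain ⟨U, b₁, f₁, g₁, hp, hc₁, hb⟩ := exists_pull h c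
  exact ⟨U, b₁, f₁, g₁, hc₁, hp.w, hb, pull_mk h hc₁ c b₁ hp.w hb⟩

lemma push_id (d : 𝓔.Ext1 Y X) : push (𝟙 X) d = d := by
  induction d using ind with | h h
  exact push_mk h h _ (𝟙 _) (by simp) (by simp)

lemma pull_id (d : 𝓔.Ext1 Y X) : pull (𝟙 Y) d = d := by
  induction d using ind with | h h
  exact pull_mk h h _ (𝟙 _) (by simp) (by simp)

lemma push_comp {X'' : C} (a : X ⟶ X') (a' : X' ⟶ X'') (d : 𝓔.Ext1 Y X) :
    push (a ≫ a') d = push a' (push a d) := by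
  induction d using ind with | h h
  obtain ⟨W', b, f', g', h', h₁, h₂, e⟩ := exists_push_mk h a
  obtain ⟨W'', b', f'', g'', h'', h₁', h₂', e'⟩ := exists_push_mk h' a'
  rw [e, e']
  exact push_mk h h'' _ (b ≫ b') (by rw [reassoc_of% h₁, h₁', Category.assoc])
    (by rw [Category.assoc, h₂', h₂])

lemma pull_comp {Y'' : C} (c : Y' ⟶ Y) (c' : Y'' ⟶ Y') (d : 𝓔.Ext1 Y X) :
    pull (c' ≫ c) d = pull c' (pull c d) := by
  induction d using ind with | h h
  obtain ⟨W', b, f', g', h', h₁, h₂, e⟩ := exists_pull_mk h c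
  obtain ⟨W'', b', f'', g'', h'', h₁', h₂', e'⟩ := exists_pull_mk h' c'
  rw [e, e']
  exact pull_mk h h'' _ (b' ≫ b) (by rw [Category.assoc, h₁, reassoc_of% h₁'])
    (by rw [reassoc_of% h₂', h₂])

lemma push_pull (a : X ⟶ X') (c : Y' ⟶ Y) (d : 𝓔.Ext1 Y X) :
    push a (pull c d) = pull c (push a d) := by
  induction d using ind with | h h
  obtain ⟨W', b, f', g', h', h₁, h₂, e⟩ := exists_pull_mk h c
  obtain ⟨W'', b', f'', g'', h'', h₁', h₂', e'⟩ := exists_push_mk h a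
  rw [e, e', push_eq_pull_iff]
  exact ⟨b ≫ b', by rw [reassoc_of% h₂, h₁'], by rw [Category.assoc, h₂', h₁]⟩

/-- The direct sum of two extensions. -/
noncomputable def osum : 𝓔.Ext1 Y X → 𝓔.Ext1 Y' X' → 𝓔.Ext1 (Y ⊞ Y') (X ⊞ X') :=
  Quotient.lift₂ (fun S S' => mk (biprod_conflation S.conf S'.conf)) (by
    rintro S S' T T' ⟨e, h₁, h₂⟩ ⟨e', h₁', h₂'⟩
    refine mk_eq_of_morphism _ _ (biprod.map e.hom e'.hom) ?_ ?_
    · ext <;> simp [h₁, h₁']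
    · ext <;> simp [h₂, h₂'])

lemma osum_mk (h : 𝓔.IsConflation f g) (h' : 𝓔.IsConflation f' g') :
    osum (mk h) (mk h') = mk (biprod_conflation h h') := rfl

lemma push_osum {V V' : C} (a : X ⟶ V) (a' : X' ⟶ V') (d : 𝓔.Ext1 Y X) (d' : 𝓔.Ext1 Y' X') :
    push (biprod.map a a') (osum d d') = osum (push a d) (push a' d') := by
  induction d using ind with | h h
  induction d' using ind with | h h'
  obtain ⟨_, b, _, _, k, h₁, h₂, e⟩ := exists_push_mk h a
  obtain ⟨_, b', _, _, k', h₁', h₂', e'⟩ := exists_push_mk h' a'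
  rw [e, e', osum_mk, osum_mk]
  refine push_mk _ _ _ (biprod.map b b') ?_ ?_
  · ext <;> simp [h₁, h₁']
  · ext <;> simp [h₂, h₂']

lemma pull_osum {V V' : C} (c : V ⟶ Y) (c' : V' ⟶ Y') (d : 𝓔.Ext1 Y X) (d' : 𝓔.Ext1 Y' X') :
    pull (biprod.map c c') (osum d d') = osum (pull c d) (pull c' d') := by
  induction d using ind with | h h
  induction d' using ind with | h h'
  obtain ⟨_, b, _, _, k, h₁, h₂, e⟩ := exists_pull_mk h c
  obtain ⟨_, b', _, _, k', h₁', h₂', e'⟩ := exists_pull_mk h' c'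
  rw [e, e', osum_mk, osum_mk]
  refine pull_mk _ _ _ (biprod.map b b') ?_ ?_
  · ext <;> simp [h₁, h₁']
  · ext <;> simp [h₂, h₂']

/-- The class of the split sequence is the zero element of `Ext¹`. -/
noncomputable instance : Zero (𝓔.Ext1 Y X) := ⟨mk (split_conflation 𝓔 X Y)⟩

/-- The Baer sum. -/
noncomputable instance : Add (𝓔.Ext1 Y X) :=
  ⟨fun d d' => push (biprod.desc (𝟙 X) (𝟙 X)) (pull (biprod.lift (𝟙 Y) (𝟙 Y)) (osum d d'))⟩

noncomputable instance : Neg (𝓔.Ext1 Y X) := ⟨push (-𝟙 X)⟩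

lemma zero_def : (0 : 𝓔.Ext1 Y X) = mk (split_conflation 𝓔 X Y) := rfl

lemma add_def (d d' : 𝓔.Ext1 Y X) :
    d + d' = push (biprod.desc (𝟙 X) (𝟙 X)) (pull (biprod.lift (𝟙 Y) (𝟙 Y)) (osum d d')) := rfl

lemma push_zero_hom (d : 𝓔.Ext1 Y X) : push (0 : X ⟶ X') d = 0 := by
  induction d using ind with | @h _ _ g h
  refine push_mk h _ _ (biprod.lift 0 g) ?_ ?_
  · ext <;> simp [𝓔.comp_eq_zero h]
  · simp

lemma pull_zero_hom (d : 𝓔.Ext1 Y X) : pull (0 : Y' ⟶ Y) d = 0 := by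
  induction d using ind with | @h _ f g h
  refine pull_mk h _ _ (biprod.desc f 0) ?_ ?_
  · ext <;> simp [𝓔.comp_eq_zero h]
  · simp

lemma push_diag (d : 𝓔.Ext1 Y X) :
    push (biprod.lift (𝟙 X) (𝟙 X)) d = pull (biprod.lift (𝟙 Y) (𝟙 Y)) (osum d d) := by
  induction d using ind with | @h W f g h
  rw [osum_mk, push_eq_pull_iff]
  refine ⟨biprod.lift (𝟙 W) (𝟙 W), ?_, ?_⟩ <;> ext <;> simp

lemma push_codiag (d : 𝓔.Ext1 Y X) :
    push (biprod.desc (𝟙 X) (𝟙 X)) (osum d d) = pull (biprod.desc (𝟙 Y) (𝟙 Y)) d := by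
  induction d using ind with | @h W f g h
  rw [osum_mk, push_eq_pull_iff]
  refine ⟨biprod.desc (𝟙 W) (𝟙 W), ?_, ?_⟩ <;> ext <;> simp

lemma push_hom_add (a a' : X ⟶ X') (d : 𝓔.Ext1 Y X) : push (a + a') d = push a d + push a' d := by
  have e : a + a' =
      biprod.lift (𝟙 X) (𝟙 X) ≫ biprod.map a a' ≫ biprod.desc (𝟙 X') (𝟙 X') := by
    simp [biprod.desc_eq]
  rw [e, push_comp, push_comp, push_diag, push_pull, push_osum, add_def]

lemma pull_hom_add (c c' : Y' ⟶ Y) (d : 𝓔.Ext1 Y X) : pull (c + c') d = pull c d + pull c' d := by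
  have e : c + c' =
      biprod.lift (𝟙 Y') (𝟙 Y') ≫ biprod.map c c' ≫ biprod.desc (𝟙 Y) (𝟙 Y) := by
    simp [biprod.desc_eq]
  rw [e, pull_comp, pull_comp, ← push_codiag, ← push_pull, ← push_pull, pull_osum, add_def]

lemma push_add (a : X ⟶ X') (d d' : 𝓔.Ext1 Y X) : push a (d + d') = push a d + push a d' := by
  have e : biprod.desc (𝟙 X) (𝟙 X) ≫ a = biprod.map a a ≫ biprod.desc (𝟙 X') (𝟙 X') := by
    ext <;> simp
  rw [add_def, ← push_comp, e, push_comp, push_pull, push_osum, add_def]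

lemma pull_add (c : Y' ⟶ Y) (d d' : 𝓔.Ext1 Y X) : pull c (d + d') = pull c d + pull c d' := by
  have e : c ≫ biprod.lift (𝟙 Y) (𝟙 Y) = biprod.lift (𝟙 Y') (𝟙 Y') ≫ biprod.map c c := by
    ext <;> simp
  rw [add_def, ← push_pull, ← pull_comp, e, pull_comp, pull_osum, add_def]

lemma osum_swap (d : 𝓔.Ext1 Y X) (d' : 𝓔.Ext1 Y' X') :
    push (biprod.braiding X X').hom (osum d d') =
      pull (biprod.braiding Y Y').hom (osum d' d) := by
  induction d using ind with | @h W f g h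
  induction d' using ind with | @h W' f' g' h'
  rw [osum_mk, osum_mk, push_eq_pull_iff]
  refine ⟨(biprod.braiding W W').hom, ?_, ?_⟩ <;> ext <;> simp

lemma osum_assoc {X'' Y'' : C} (d : 𝓔.Ext1 Y X) (d' : 𝓔.Ext1 Y' X') (d'' : 𝓔.Ext1 Y'' X'') :
    push (biprod.associator X X' X'').hom (osum (osum d d') d'') =
      pull (biprod.associator Y Y' Y'').hom (osum d (osum d' d'')) := by
  induction d using ind with | @h W f g h
  induction d' using ind with | @h W' f' g' h'
  induction d'' using ind with | @h W'' f'' g'' h''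
  rw [osum_mk, osum_mk, osum_mk, osum_mk, push_eq_pull_iff]
  refine ⟨(biprod.associator W W' W'').hom, ?_, ?_⟩ <;> ext <;> simp

protected lemma add_comm (d d' : 𝓔.Ext1 Y X) : d + d' = d' + d := by
  have e₁ : biprod.desc (𝟙 X) (𝟙 X) = (biprod.braiding X X).hom ≫ biprod.desc (𝟙 X) (𝟙 X) := by
    ext <;> simp
  have e₂ : biprod.lift (𝟙 Y) (𝟙 Y) ≫ (biprod.braiding Y Y).hom = biprod.lift (𝟙 Y) (𝟙 Y) := by
    ext <;> simp
  rw [add_def, e₁, push_comp, push_pull (biprod.braiding X X).hom, osum_swap, ← pull_comp, e₂,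
    add_def]

protected lemma add_assoc (d d' d'' : 𝓔.Ext1 Y X) : d + d' + d'' = d + (d' + d'') := by
  set m := biprod.desc (𝟙 X) (𝟙 X) with hm
  set δ := biprod.lift (𝟙 Y) (𝟙 Y) with hδ
  have l : d + d' + d'' = push (biprod.map m (𝟙 X) ≫ m) (pull (δ ≫ biprod.map δ (𝟙 Y))
      (osum (osum d d') d'')) := by
    rw [push_comp, pull_comp, push_pull, pull_osum, push_osum, push_id, pull_id]; rfl
  have r : d + (d' + d'') = push (biprod.map (𝟙 X) m ≫ m) (pull (δ ≫ biprod.map (𝟙 Y) δ)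
      (osum d (osum d' d''))) := by
    rw [push_comp, pull_comp, push_pull, pull_osum, push_osum, push_id, pull_id]; rfl
  have e₁ : biprod.map m (𝟙 X) ≫ m = (biprod.associator X X X).hom ≫ biprod.map (𝟙 X) m ≫ m := by
    ext <;> simp [hm, biprod.desc_eq]
  have e₂ : (δ ≫ biprod.map δ (𝟙 Y)) ≫ (biprod.associator Y Y Y).hom =
      δ ≫ biprod.map (𝟙 Y) δ := by
    ext <;> simp [hδ]
  rw [l, r, e₁, push_comp, push_pull (biprod.associator X X X).hom, osum_assoc, ← pull_comp, e₂]

protected lemma zero_add (d : 𝓔.Ext1 Y X) : 0 + d = d := by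
  rw [← push_zero_hom (X' := X) d]
  nth_rw 2 [← push_id d]
  rw [← push_hom_add, zero_add, push_id]

protected lemma neg_add_cancel (d : 𝓔.Ext1 Y X) : -d + d = 0 := by
  change push (-𝟙 X) d + d = 0
  nth_rw 2 [← push_id d]
  rw [← push_hom_add, neg_add_cancel, push_zero_hom]

noncomputable instance : AddCommGroup (𝓔.Ext1 Y X) where
  add_assoc := Ext1.add_assoc
  zero_add := Ext1.zero_add
  add_zero d := by rw [Ext1.add_comm, Ext1.zero_add]
  nsmul := nsmulRec
  zsmul := zsmulRec
  neg_add_cancel := Ext1.neg_add_cancel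
  add_comm := Ext1.add_comm

/-- The underlying class of three-term sequences of an extension. -/
def toSeqClass : 𝓔.Ext1 Y X → SeqClass X Y :=
  Quotient.lift (fun S => Quotient.mk _ S.toThreeTerm) (fun _ _ h => Quotient.sound h)

lemma toSeqClass_mk (h : 𝓔.IsConflation f g) : toSeqClass (mk h) = SeqClass.mk f g := rfl

lemma eq_mk_of_toSeqClass_eq {d : 𝓔.Ext1 Y X} (e : toSeqClass d = SeqClass.mk f g) :
    ∃ h : 𝓔.IsConflation f g, d = mk h := by
  induction d using ind with | @h W' f' g' h'
  rw [toSeqClass_mk, SeqClass.mk_eq_mk_iff] at e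
  obtain ⟨t, h₁, h₂⟩ := e
  have h : 𝓔.IsConflation f g :=
    𝓔.of_iso h' (Iso.refl _) t (Iso.refl _) (by simp [h₁]) (by simp [h₂])
  exact ⟨h, mk_eq_of_morphism h' h t.hom h₁ h₂⟩

lemma osum_eq (d : 𝓔.Ext1 Y X) (d' : 𝓔.Ext1 Y' X') :
    push biprod.inl (pull biprod.fst d) + push biprod.inr (pull biprod.snd d') = osum d d' := by
  have h₁ : push biprod.fst (osum d d') = pull biprod.fst d := by
    induction d using ind with | @h W f g h
    induction d' using ind with | @h W' f' g' h'
    rw [osum_mk, push_eq_pull_iff]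
    exact ⟨biprod.fst, by simp, by simp⟩
  have h₂ : push biprod.snd (osum d d') = pull biprod.snd d' := by
    induction d using ind with | @h W f g h
    induction d' using ind with | @h W' f' g' h'
    rw [osum_mk, push_eq_pull_iff]
    exact ⟨biprod.snd, by simp, by simp⟩
  rw [← h₁, ← h₂, ← push_comp, ← push_comp, ← push_hom_add, biprod.total, push_id]

end Ext1

open Ext1 in
lemma exists_et4 {A B D V F : C} {f : A ⟶ B} {f' : B ⟶ D} {g : B ⟶ V} {g' : V ⟶ F}
    (h : 𝓔.IsConflation f f') (h' : 𝓔.IsConflation g g') :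
    ∃ (G : C) (q : V ⟶ G) (k : D ⟶ G) (l : G ⟶ F) (hq : 𝓔.IsConflation (f ≫ g) q)
      (hk : 𝓔.IsConflation k l), f' ≫ k = g ≫ q ∧ q ≫ l = g' ∧
      push f' (Ext1.mk h') = Ext1.mk hk ∧ pull k (Ext1.mk hq) = Ext1.mk h ∧ push f (Ext1.mk hq) = pull l (Ext1.mk h') := by
  obtain ⟨G, q, k, l, hp, hk, hl⟩ := exists_push h' f'
  have := epi h
  have : Epi q := ⟨fun s t e => hp.hom_ext e (by
    rw [← cancel_epi f', ← reassoc_of% hp.w, ← reassoc_of% hp.w, e])⟩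
  have hq : 𝓔.IsConflation (f ≫ g) q := by
    refine of_cokernel (𝓔.comp_inflation ⟨_, _, h⟩ ⟨_, _, h'⟩) ?_ ?_
    · rw [Category.assoc, hp.w, reassoc_of% (𝓔.comp_eq_zero h), zero_comp]
    · intro Z t ht
      obtain ⟨m, hm⟩ := desc h (g ≫ t) (by rw [← Category.assoc, ht])
      exact ⟨hp.desc t m hm.symm, hp.inl_desc _ _ _⟩
  exact ⟨G, q, k, l, hq, hk, hp.w.symm, hl, push_mk _ _ _ q hp.w hl,
    pull_mk _ _ _ g hp.w rfl, (push_eq_pull_iff _ _ _ _).2 ⟨𝟙 _, by simp, by simp [hl]⟩⟩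

open Ext1 in
lemma exists_et4_op {D A B F V : C} {f' : D ⟶ A} {f : A ⟶ B} {g' : F ⟶ B} {g : B ⟶ V}
    (h : 𝓔.IsConflation f' f) (h' : 𝓔.IsConflation g' g) :
    ∃ (G : C) (j : G ⟶ A) (k : D ⟶ G) (l : G ⟶ F) (hj : 𝓔.IsConflation j (f ≫ g))
      (hk : 𝓔.IsConflation k l), j ≫ f = l ≫ g' ∧ k ≫ j = f' ∧
      pull g' (Ext1.mk h) = Ext1.mk hk ∧ push l (Ext1.mk hj) = Ext1.mk h' ∧ push k (Ext1.mk h) = pull g (Ext1.mk hj) := by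
  obtain ⟨G, j, k, l, hp, hk, hl⟩ := exists_pull h g'
  have := mono h'
  have : Mono j := ⟨fun s t e => hp.hom_ext e (by
    rw [← cancel_mono g', Category.assoc, Category.assoc, ← hp.w, reassoc_of% e])⟩
  have hj : 𝓔.IsConflation j (f ≫ g) := by
    refine of_kernel (𝓔.comp_deflation ⟨_, _, h⟩ ⟨_, _, h'⟩) ?_ ?_
    · rw [reassoc_of% hp.w, 𝓔.comp_eq_zero h', comp_zero]
    · intro Z t ht
      obtain ⟨m, hm⟩ := lift h' (t ≫ f) (by rw [Category.assoc, ht])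
      exact ⟨hp.lift t m hm.symm, hp.lift_fst _ _ _⟩
  exact ⟨G, j, k, l, hj, hk, hp.w, hl, pull_mk _ _ _ j hp.w hl,
    push_mk _ _ _ f hp.w rfl, (push_eq_pull_iff _ _ _ _).2 ⟨𝟙 _, by simp [hl], by simp⟩⟩

variable (𝓔)

open Ext1 in
/-- An exact category viewed as an extriangulated category: the extension groups are `Ext¹`
and the realisation sends a class of short exact sequences to itself. -/
noncomputable def extriangulated : ExtriangulatedStructure.{max u v} C where
  E := 𝓔.Ext1
  push a := AddMonoidHom.mk' (push a) (push_add a)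
  pull c := AddMonoidHom.mk' (pull c) (pull_add c)
  push_id := push_id
  push_comp := push_comp
  pull_id := pull_id
  pull_comp := pull_comp
  push_pull := push_pull
  push_add := push_hom_add
  pull_add := pull_hom_add
  s := toSeqClass
  realize h h' a c e := by
    obtain ⟨hc, rfl⟩ := eq_mk_of_toSeqClass_eq h
    obtain ⟨hc', rfl⟩ := eq_mk_of_toSeqClass_eq h'
    exact (push_eq_pull_iff hc hc' a c).1 e
  s_zero _ _ := rfl
  s_biprod h h' := by
    obtain ⟨hc, rfl⟩ := eq_mk_of_toSeqClass_eq h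
    obtain ⟨hc', rfl⟩ := eq_mk_of_toSeqClass_eq h'
    exact congrArg toSeqClass (osum_eq (Ext1.mk hc) (Ext1.mk hc'))
  et3 := by
    intro X W Y X' W' Y' f g f' g' d d' h h' a b e
    obtain ⟨hc, rfl⟩ := eq_mk_of_toSeqClass_eq h
    obtain ⟨hc', rfl⟩ := eq_mk_of_toSeqClass_eq h'
    obtain ⟨c, hg⟩ := desc hc (b ≫ g') (by
      rw [reassoc_of% e, 𝓔.comp_eq_zero hc', comp_zero])
    exact ⟨c, hg, (push_eq_pull_iff hc hc' a c).2 ⟨b, e, hg⟩⟩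
  et3_op := by
    intro X W Y X' W' Y' f g f' g' d d' h h' b c e
    obtain ⟨hc, rfl⟩ := eq_mk_of_toSeqClass_eq h
    obtain ⟨hc', rfl⟩ := eq_mk_of_toSeqClass_eq h'
    obtain ⟨a, ha⟩ := lift hc' (f ≫ b) (by
      rw [Category.assoc, ← e, reassoc_of% (𝓔.comp_eq_zero hc), zero_comp])
    exact ⟨a, ha.symm, (push_eq_pull_iff hc hc' a c).2 ⟨b, ha.symm, e⟩⟩
  et4 := by
    intro A B D V F f f' g g' d d' h h'
    obtain ⟨hc, rfl⟩ := eq_mk_of_toSeqClass_eq h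
    obtain ⟨hc', rfl⟩ := eq_mk_of_toSeqClass_eq h'
    obtain ⟨G, q, k, l, hq, hk, e₁, e₂, e₃, e₄, e₅⟩ := exists_et4 hc hc'
    exact ⟨G, q, k, l, Ext1.mk hq, e₁, e₂, rfl, congrArg toSeqClass e₃, e₄, e₅⟩
  et4_op := by
    intro D A B F V f' f g' g d d' h h'
    obtain ⟨hc, rfl⟩ := eq_mk_of_toSeqClass_eq h
    obtain ⟨hc', rfl⟩ := eq_mk_of_toSeqClass_eq h'
    obtain ⟨G, j, k, l, hj, hk, e₁, e₂, e₃, e₄, e₅⟩ := exists_et4_op hc hc'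
    exact ⟨G, j, k, l, Ext1.mk hj, e₁, e₂, rfl, congrArg toSeqClass e₃, e₄, e₅⟩

end ExactStructure

/-! ### Higher extensions and cup products -/

namespace ExtriangulatedStructure

variable {C : Type u} [Category.{v} C] [Preadditive C] [HasZeroObject C] [HasBinaryBiproducts C]
  (𝓒 : ExtriangulatedStructure.{w} C)

open Classical in
/-- The relations `(f^* d) ⊗ e = d ⊗ (f_* e)` that define the coend of
`E(-, X) ⊗ E(Y, -)` as a quotient of a direct sum. -/
def coendRelations (Y X : C) : Set (DirectSum C fun W => 𝓒.E W X ⊗[ℤ] 𝓒.E Y W) :=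
  {t | ∃ (V V' : C) (f : V ⟶ V') (d : 𝓒.E V' X) (e : 𝓒.E Y V),
    t = DirectSum.of (fun W => 𝓒.E W X ⊗[ℤ] 𝓒.E Y W) V (𝓒.pull f d ⊗ₜ[ℤ] e) -
      DirectSum.of (fun W => 𝓒.E W X ⊗[ℤ] 𝓒.E Y W) V' (d ⊗ₜ[ℤ] 𝓒.push f e)}

/-- The second extension group `E²(Y, X)`, the coend `∫^W E(W, X) ⊗ E(Y, W)` of abelian
groups. No smallness is needed, since the group may live in a larger universe. -/
def E2 (Y X : C) : Type (max u w) :=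
  (DirectSum C fun W => 𝓒.E W X ⊗[ℤ] 𝓒.E Y W) ⧸ AddSubgroup.closure (𝓒.coendRelations Y X)

noncomputable instance (Y X : C) : AddCommGroup (𝓒.E2 Y X) :=
  inferInstanceAs (AddCommGroup (_ ⧸ AddSubgroup.closure (𝓒.coendRelations Y X)))

open Classical in
/-- The cup product `E(Y, X) × E(Z, Y) → E²(Z, X)`. -/
noncomputable def cup {X Y Z : C} (d : 𝓒.E Y X) (e : 𝓒.E Z Y) : 𝓒.E2 Z X :=
  QuotientAddGroup.mk (DirectSum.of (fun W => 𝓒.E W X ⊗[ℤ] 𝓒.E Z W) Y (d ⊗ₜ[ℤ] e))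

/-- `P` is projective with respect to the extriangulated structure. -/
def IsProjective (P : C) : Prop := ∀ (X : C) (d : 𝓒.E P X), d = 0

/-- `I` is injective with respect to the extriangulated structure. -/
def IsInjective (I : C) : Prop := ∀ (Y : C) (d : 𝓒.E Y I), d = 0

/-- A choice of syzygies: for every object `X` an extriangle `Ω X ⟶ P X ⟶ X ⇢` with `P X`
projective. Such a choice exists if and only if there are enough projectives. -/
structure Syzygies where
  Ω : C → C
  P : C → C
  ι : ∀ X, Ω X ⟶ P X
  π : ∀ X, P X ⟶ X
  ω : ∀ X, 𝓒.E X (Ω X)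
  isProjective : ∀ X, 𝓒.IsProjective (P X)
  s_ω : ∀ X, 𝓒.s (ω X) = SeqClass.mk (ι X) (π X)

/-- A choice of cosyzygies: for every object `X` an extriangle `X ⟶ I X ⟶ Σ X ⇢` with `I X`
injective. Such a choice exists if and only if there are enough injectives. -/
structure Cosyzygies where
  S : C → C
  I : C → C
  ι : ∀ X, X ⟶ I X
  π : ∀ X, I X ⟶ S X
  ω : ∀ X, 𝓒.E (S X) X
  isInjective : ∀ X, 𝓒.IsInjective (I X)
  s_ω : ∀ X, 𝓒.s (ω X) = SeqClass.mk (ι X) (π X)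

namespace Syzygies

variable {𝓒} (𝓢 : 𝓒.Syzygies)

/-- The map `Hom(Ω Z, Y) → E(Z, Y)`, `a ↦ a_* ω`, is surjective. -/
lemma exists_lift {Z Y : C} (e : 𝓒.E Z Y) : ∃ a : 𝓢.Ω Z ⟶ Y, 𝓒.push a (𝓢.ω Z) = e := by
  obtain ⟨W, f, g, hW⟩ := SeqClass.exists_rep (𝓒.s e)
  obtain ⟨b, -, hb⟩ := 𝓒.realize (𝓒.s_zero (𝓢.P Z) Y) hW (𝟙 Y) (𝓢.π Z) (by
    rw [𝓢.isProjective Z Y (𝓒.pull _ e), map_zero])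
  obtain ⟨a, -, ha⟩ := 𝓒.et3_op (𝓢.s_ω Z) hW (biprod.inr ≫ b) (𝟙 Z) (by
    rw [Category.assoc, ← hb, biprod.inr_snd_assoc, Category.comp_id])
  exact ⟨a, by rw [ha, 𝓒.pull_id]⟩

/-- The cup product `E(Y, X) × E(Z, Y) → E(Ω Z, X)` on the second extensions defined
via syzygies: `d ⌣ e = a^* d` for any preimage `a : Ω Z ⟶ Y` of `e`. -/
noncomputable def cup {X Y Z : C} (d : 𝓒.E Y X) (e : 𝓒.E Z Y) : 𝓒.E (𝓢.Ω Z) X :=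
  𝓒.pull (𝓢.exists_lift e).choose d

/-- The cup product does not depend on the preimage. -/
lemma cup_eq {X Y Z : C} (d : 𝓒.E Y X) (a : 𝓢.Ω Z ⟶ Y) :
    𝓢.cup d (𝓒.push a (𝓢.ω Z)) = 𝓒.pull a d := by
  have h := (𝓢.exists_lift (𝓒.push a (𝓢.ω Z))).choose_spec
  unfold cup
  set a' := (𝓢.exists_lift (𝓒.push a (𝓢.ω Z))).choose
  obtain ⟨b, hb, -⟩ := 𝓒.realize (𝓢.s_ω Z) (𝓒.s_zero Z Y) (a' - a) (𝟙 Z) (by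
    have := 𝓒.push_add (a' - a) a (𝓢.ω Z)
    rw [sub_add_cancel, h, right_eq_add] at this
    rw [this, map_zero])
  have e : a' = 𝓢.ι Z ≫ b ≫ biprod.fst + a := by
    rw [reassoc_of% hb, biprod.inl_fst, Category.comp_id, sub_add_cancel]
  rw [e, 𝓒.pull_add, 𝓒.pull_comp, 𝓢.isProjective Z X (𝓒.pull _ d), map_zero, zero_add]

end Syzygies

namespace Cosyzygies

variable {𝓒} (𝓢 : 𝓒.Cosyzygies)

/-- The map `Hom(Y, Σ X) → E(Y, X)`, `c ↦ c^* ω`, is surjective. -/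
lemma exists_lift {Y X : C} (d : 𝓒.E Y X) : ∃ c : Y ⟶ 𝓢.S X, 𝓒.pull c (𝓢.ω X) = d := by
  obtain ⟨W, f, g, hW⟩ := SeqClass.exists_rep (𝓒.s d)
  obtain ⟨b, hb, -⟩ := 𝓒.realize hW (𝓒.s_zero Y (𝓢.I X)) (𝓢.ι X) (𝟙 Y) (by
    rw [𝓢.isInjective X Y (𝓒.push _ d), map_zero])
  obtain ⟨c, -, hc⟩ := 𝓒.et3 hW (𝓢.s_ω X) (𝟙 X) (b ≫ biprod.fst) (by
    rw [reassoc_of% hb, biprod.inl_fst, Category.comp_id, Category.id_comp])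
  exact ⟨c, by rw [← hc, 𝓒.push_id]⟩

/-- The cup product `E(Y, X) × E(Z, Y) → E(Z, Σ X)` on the second extensions defined
via cosyzygies: `d ⌣ e = c_* e` for any preimage `c : Y ⟶ Σ X` of `d`. -/
noncomputable def cup {X Y Z : C} (d : 𝓒.E Y X) (e : 𝓒.E Z Y) : 𝓒.E Z (𝓢.S X) :=
  𝓒.push (𝓢.exists_lift d).choose e

/-- The cup product does not depend on the preimage. -/
lemma cup_eq {X Y Z : C} (c : Y ⟶ 𝓢.S X) (e : 𝓒.E Z Y) :
    𝓢.cup (𝓒.pull c (𝓢.ω X)) e = 𝓒.push c e := by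
  have h := (𝓢.exists_lift (𝓒.pull c (𝓢.ω X))).choose_spec
  unfold cup
  set c' := (𝓢.exists_lift (𝓒.pull c (𝓢.ω X))).choose
  obtain ⟨b, -, hb⟩ := 𝓒.realize (𝓒.s_zero Y X) (𝓢.s_ω X) (𝟙 X) (c' - c) (by
    have := 𝓒.pull_add (c' - c) c (𝓢.ω X)
    rw [sub_add_cancel, h, right_eq_add] at this
    rw [this, map_zero])
  have e' : c' = (biprod.inr ≫ b) ≫ 𝓢.π X + c := by
    rw [Category.assoc, ← hb, biprod.inr_snd_assoc, sub_add_cancel]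
  rw [e', 𝓒.push_add, 𝓒.push_comp, 𝓢.isInjective X Z (𝓒.push _ e), map_zero, zero_add]

end Cosyzygies

/-- The three constructions of the higher extensions of an extriangulated category: via coends,
via syzygies (when there are enough projectives) and via cosyzygies (when there are enough
injectives). -/
inductive HigherExtensions : Type (max u v w)
  | coend : HigherExtensions
  | syzygy (S : 𝓒.Syzygies) : HigherExtensions
  | cosyzygy (S : 𝓒.Cosyzygies) : HigherExtensions

end ExtriangulatedStructure

/-! ### Extriangulated and biextriangulated functors -/

section Functors

universe w₁ w₂ w₃

variable {A : Type u₁} [Category.{v₁} A] [Preadditive A] [HasZeroObject A] [HasBinaryBiproducts A]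
  {B : Type u₂} [Category.{v₂} B] [Preadditive B] [HasZeroObject B] [HasBinaryBiproducts B]
  {C : Type u₃} [Category.{v₃} C] [Preadditive C] [HasZeroObject C] [HasBinaryBiproducts C]

/-- The structure of an extriangulated functor on a functor `F`: `F` is additive, and there is a
natural transformation `β : E(-, -) ⟶ E(F -, F -)` of functors to abelian groups such that `F`
sends an extriangle realising `d` to an extriangle realising `β d`. -/
structure ExtriangulatedFunctorStructure (𝓐 : ExtriangulatedStructure.{w₁} A)
    (𝓑 : ExtriangulatedStructure.{w₂} B) (F : A ⥤ B) where
  additive : F.Additive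
  β : ∀ Y X : A, 𝓐.E Y X →+ 𝓑.E (F.obj Y) (F.obj X)
  β_push : ∀ {Y X X' : A} (a : X ⟶ X') (d : 𝓐.E Y X),
    β Y X' (𝓐.push a d) = 𝓑.push (F.map a) (β Y X d)
  β_pull : ∀ {Y Y' X : A} (c : Y' ⟶ Y) (d : 𝓐.E Y X),
    β Y' X (𝓐.pull c d) = 𝓑.pull (F.map c) (β Y X d)
  s_β : ∀ {X W Y : A} {f : X ⟶ W} {g : W ⟶ Y} {d : 𝓐.E Y X}, 𝓐.s d = SeqClass.mk f g →
    𝓑.s (β Y X d) = SeqClass.mk (F.map f) (F.map g)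

/-- A biextriangulated functor `(F, φ, ψ)`. The bifunctor is curried: `F(X, Y)` is
`(functor.obj X).obj Y`, the functor `F(X, -)` is `functor.obj X` and the functor `F(-, Y)` is
`functor.flip.obj Y`. -/
structure BiextriangulatedFunctor (𝓐 : ExtriangulatedStructure.{w₁} A)
    (𝓑 : ExtriangulatedStructure.{w₂} B) (𝓒 : ExtriangulatedStructure.{w₃} C) where
  functor : A ⥤ B ⥤ C
  left : ∀ Y : B, ExtriangulatedFunctorStructure 𝓐 𝓒 (functor.flip.obj Y)
  right : ∀ X : A, ExtriangulatedFunctorStructure 𝓑 𝓒 (functor.obj X)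
  left_extranatural : ∀ {X X' : A} {Y Y' : B} (g : Y ⟶ Y') (d : 𝓐.E X' X),
    𝓒.push ((functor.obj X).map g) ((left Y).β X' X d) =
      𝓒.pull ((functor.obj X').map g) ((left Y').β X' X d)
  right_extranatural : ∀ {X X' : A} {Y Y' : B} (f : X ⟶ X') (e : 𝓑.E Y' Y),
    𝓒.push ((functor.map f).app Y) ((right X).β Y' Y e) =
      𝓒.pull ((functor.map f).app Y') ((right X').β Y' Y e)

namespace BiextriangulatedFunctor

variable {𝓐 : ExtriangulatedStructure.{w₁} A} {𝓑 : ExtriangulatedStructure.{w₂} B}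
  {𝓒 : ExtriangulatedStructure.{w₃} C} (F : BiextriangulatedFunctor 𝓐 𝓑 𝓒)

/-- `φ^Y : E(X', X) → E(F(X', Y), F(X, Y))`. -/
def φ (Y : B) {X' X : A} :
    𝓐.E X' X →+ 𝓒.E ((F.functor.obj X').obj Y) ((F.functor.obj X).obj Y) :=
  (F.left Y).β X' X

/-- `ψ^X : E(Y', Y) → E(F(X, Y'), F(X, Y))`. -/
def ψ (X : A) {Y' Y : B} :
    𝓑.E Y' Y →+ 𝓒.E ((F.functor.obj X).obj Y') ((F.functor.obj X).obj Y) :=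
  (F.right X).β Y' Y

/-- A biextriangulated functor is strong, with respect to a construction of the higher extensions
of the target, if `ψ^{X'}(e) ⌣ φ^Y(d) = - φ^{Y'}(d) ⌣ ψ^X(e)` in the second extension group of
`F(X, Y)` by `F(X', Y')`, for all `d` in `E(X, X')` and all `e` in `E(Y, Y')`. -/
def IsStrong : 𝓒.HigherExtensions → Prop
  | .coend => ∀ {X X' : A} {Y Y' : B} (d : 𝓐.E X X') (e : 𝓑.E Y Y'),
      𝓒.cup (F.ψ X' e) (F.φ Y d) = -𝓒.cup (F.φ Y' d) (F.ψ X e)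
  | .syzygy S => ∀ {X X' : A} {Y Y' : B} (d : 𝓐.E X X') (e : 𝓑.E Y Y'),
      S.cup (F.ψ X' e) (F.φ Y d) = -S.cup (F.φ Y' d) (F.ψ X e)
  | .cosyzygy S => ∀ {X X' : A} {Y Y' : B} (d : 𝓐.E X X') (e : 𝓑.E Y Y'),
      S.cup (F.ψ X' e) (F.φ Y d) = -S.cup (F.φ Y' d) (F.ψ X e)

end BiextriangulatedFunctor

/-! ### Exact and biexact functors -/

/-- A functor of exact categories is exact if it sends short exact sequences to short exact
sequences. -/
structure IsExactFunctor (𝓔 : ExactStructure A) (𝓕 : ExactStructure B) (F : A ⥤ B) : Prop where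
  map : ∀ {X W Y : A} {f : X ⟶ W} {g : W ⟶ Y}, 𝓔.IsConflation f g → 𝓕.IsConflation (F.map f) (F.map g)

namespace IsExactFunctor

open ExactStructure
open scoped ZeroObject

variable {𝓔 : ExactStructure A} {𝓕 : ExactStructure B} {F : A ⥤ B}

lemma additive (hF : IsExactFunctor 𝓔 𝓕 F) : F.Additive := by
  have hz : ∀ X Y : A, F.map (0 : X ⟶ Y) = 0 := by
    obtain ⟨Z, g, h⟩ := 𝓔.id_inflation (0 : A)
    have hg : g = 0 := (isZero_zero A).eq_of_src _ _
    have := epi h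
    have hid : 𝟙 Z = 0 := by rw [← cancel_epi g, hg]; simp
    have hF' := hF.map h
    have := epi hF'
    have h1 : F.map g = 0 := by simpa using 𝓕.comp_eq_zero hF'
    have h2 : 𝟙 (F.obj Z) = 0 := by rw [← cancel_epi (F.map g), h1]; simp
    intro X Y
    have : (0 : X ⟶ Y) = (0 : X ⟶ Z) ≫ (0 : Z ⟶ Y) := by simp
    rw [this, F.map_comp, ← Category.id_comp (F.map (0 : Z ⟶ Y)), h2, zero_comp, comp_zero]
  constructor
  intro X Y f g
  have hc := hF.map (split_conflation 𝓔 X X)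
  have := mono hc
  have tot : 𝟙 (F.obj (X ⊞ X)) =
      F.map biprod.fst ≫ F.map biprod.inl + F.map biprod.snd ≫ F.map biprod.inr := by
    obtain ⟨k, hk⟩ := lift hc (𝟙 (F.obj (X ⊞ X)) - F.map biprod.snd ≫ F.map biprod.inr) (by
      rw [Preadditive.sub_comp, Category.assoc, ← F.map_comp, biprod.inr_snd, F.map_id]
      simp)
    have hk' : k = F.map biprod.fst := by
      have := hk =≫ F.map biprod.fst
      rw [Category.assoc, ← F.map_comp, biprod.inl_fst, F.map_id, Preadditive.sub_comp,
        Category.assoc, ← F.map_comp, biprod.inr_fst, hz] at this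
      simpa using this
    rw [← hk', hk, sub_add_cancel]
  have e : f + g = biprod.lift (𝟙 X) (𝟙 X) ≫ biprod.desc f g := by simp [biprod.desc_eq]
  rw [e, F.map_comp, ← Category.id_comp (F.map (biprod.desc f g)), tot, Preadditive.add_comp,
    Preadditive.comp_add]
  simp only [Category.assoc, ← F.map_comp, biprod.inl_desc, biprod.inr_desc, biprod.lift_fst_assoc,
    biprod.lift_snd_assoc, Category.id_comp]

/-- The map on `Ext¹` obtained by applying an exact functor to short exact sequences. -/
def mapExt (hF : IsExactFunctor 𝓔 𝓕 F) {Y X : A} : 𝓔.Ext1 Y X → 𝓕.Ext1 (F.obj Y) (F.obj X) :=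
  Quotient.lift (fun S => Ext1.mk (hF.map S.conf)) (by
    rintro S T ⟨e, h₁, h₂⟩
    exact Ext1.mk_eq_of_morphism _ _ (F.map e.hom) (by rw [← F.map_comp, h₁])
      (by rw [← F.map_comp, h₂]))

lemma mapExt_mk (hF : IsExactFunctor 𝓔 𝓕 F) {X W Y : A} {f : X ⟶ W} {g : W ⟶ Y}
    (h : 𝓔.IsConflation f g) : hF.mapExt (Ext1.mk h) = Ext1.mk (hF.map h) := rfl

lemma mapExt_push (hF : IsExactFunctor 𝓔 𝓕 F) {Y X X' : A} (a : X ⟶ X') (d : 𝓔.Ext1 Y X) :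
    hF.mapExt (Ext1.push a d) = Ext1.push (F.map a) (hF.mapExt d) := by
  induction d using Ext1.ind with | h h
  obtain ⟨W', b, f', g', h', h₁, h₂, e⟩ := Ext1.exists_push_mk h a
  rw [e, mapExt_mk, mapExt_mk, Ext1.push_mk (hF.map h) (hF.map h') _ (F.map b)]
  · rw [← F.map_comp, h₁, F.map_comp]
  · rw [← F.map_comp, h₂]

lemma mapExt_pull (hF : IsExactFunctor 𝓔 𝓕 F) {Y Y' X : A} (c : Y' ⟶ Y) (d : 𝓔.Ext1 Y X) :
    hF.mapExt (Ext1.pull c d) = Ext1.pull (F.map c) (hF.mapExt d) := by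
  induction d using Ext1.ind with | h h
  obtain ⟨W', b, f', g', h', h₁, h₂, e⟩ := Ext1.exists_pull_mk h c
  rw [e, mapExt_mk, mapExt_mk, Ext1.pull_mk (hF.map h) (hF.map h') _ (F.map b)]
  · rw [← F.map_comp, h₁, F.map_comp]
  · rw [← F.map_comp, h₂]

lemma mapExt_add (hF : IsExactFunctor 𝓔 𝓕 F) {Y X : A} (d d' : 𝓔.Ext1 Y X) :
    hF.mapExt (d + d') = hF.mapExt d + hF.mapExt d' := by
  have := hF.additive
  have key : Ext1.push (biprod.lift (F.map biprod.fst) (F.map biprod.snd))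
      (hF.mapExt (Ext1.osum d d')) =
      Ext1.pull (biprod.lift (F.map biprod.fst) (F.map biprod.snd))
        (Ext1.osum (hF.mapExt d) (hF.mapExt d')) := by
    induction d using Ext1.ind with | h h
    induction d' using Ext1.ind with | h h'
    rw [Ext1.osum_mk, mapExt_mk, mapExt_mk, mapExt_mk, Ext1.osum_mk, Ext1.push_eq_pull_iff]
    refine ⟨biprod.lift (F.map biprod.fst) (F.map biprod.snd), ?_, ?_⟩ <;> ext <;>
      simp only [Category.assoc, biprod.lift_fst, biprod.lift_snd, biprod.map_fst, biprod.map_snd,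
        biprod.lift_fst_assoc, biprod.lift_snd_assoc, ← F.map_comp]
  have e₁ : F.map (biprod.desc (𝟙 X) (𝟙 X)) =
      biprod.lift (F.map biprod.fst) (F.map biprod.snd) ≫
        biprod.desc (𝟙 (F.obj X)) (𝟙 (F.obj X)) := by
    rw [biprod.lift_desc, biprod.desc_eq, F.map_add]
    simp
  have e₂ : F.map (biprod.lift (𝟙 Y) (𝟙 Y)) ≫
      biprod.lift (F.map biprod.fst) (F.map biprod.snd) =
        biprod.lift (𝟙 (F.obj Y)) (𝟙 (F.obj Y)) := by
    ext <;> simp [← F.map_comp]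
  rw [Ext1.add_def, mapExt_push, mapExt_pull, e₁, Ext1.push_comp, Ext1.push_pull, key,
    ← Ext1.pull_comp, e₂, Ext1.add_def]

/-- An exact functor viewed as an extriangulated functor. -/
noncomputable def extriangulated (hF : IsExactFunctor 𝓔 𝓕 F) :
    ExtriangulatedFunctorStructure 𝓔.extriangulated 𝓕.extriangulated F where
  additive := hF.additive
  β _ _ := AddMonoidHom.mk' hF.mapExt hF.mapExt_add
  β_push := hF.mapExt_push
  β_pull := hF.mapExt_pull
  s_β h := by
    obtain ⟨hc, rfl⟩ := Ext1.eq_mk_of_toSeqClass_eq h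
    rfl

end IsExactFunctor

/-- A biexact functor of exact categories: the functors `F(-, Y) = functor.flip.obj Y` and
`F(X, -) = functor.obj X` are exact. -/
structure BiexactFunctor (𝓔 : ExactStructure A) (𝓕 : ExactStructure B) (𝓖 : ExactStructure C) where
  functor : A ⥤ B ⥤ C
  left : ∀ Y : B, IsExactFunctor 𝓔 𝓖 (functor.flip.obj Y)
  right : ∀ X : A, IsExactFunctor 𝓕 𝓖 (functor.obj X)

open ExactStructure in
/-- A biexact functor viewed as a biextriangulated functor of the associated extriangulated
categories: `φ^Y` and `ψ^X` are obtained by applying `F(-, Y)` and `F(X, -)` to short exact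
sequences. -/
noncomputable def BiexactFunctor.toBiextriangulated {𝓔 : ExactStructure A} {𝓕 : ExactStructure B}
    {𝓖 : ExactStructure C} (F : BiexactFunctor 𝓔 𝓕 𝓖) :
    BiextriangulatedFunctor 𝓔.extriangulated 𝓕.extriangulated 𝓖.extriangulated where
  functor := F.functor
  left Y := (F.left Y).extriangulated
  right X := (F.right X).extriangulated
  left_extranatural := by
    intro X X' Y Y' k d
    induction d using Ext1.ind with | @h W f g h
    refine (Ext1.push_eq_pull_iff ((F.left Y).map h) ((F.left Y').map h) _ _).2
      ⟨(F.functor.obj W).map k, ?_, ?_⟩ <;> simp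
  right_extranatural := by
    intro X X' Y Y' k e
    induction e using Ext1.ind with | @h W f g h
    refine (Ext1.push_eq_pull_iff ((F.right X).map h) ((F.right X').map h) _ _).2
      ⟨(F.functor.map k).app W, ?_, ?_⟩ <;> simp

end Functors

end Extri

/-!
Since the realisation of an exact category is injective, the transformations `φ` and `ψ` of a
biextriangulated functor are determined by the underlying functor, and the latter sends short exact
sequences to short exact sequences. So biexact functors and biextriangulated functors are the same
(`BiexactFunctor.toBiextriangulated_injective`, `BiextriangulatedFunctor.exists_biexact`), and the
content of the theorem is that biexact functors are strong.

Applying a biexact functor to `X' ⟶ W ⟶ X` and `Y' ⟶ V ⟶ Y` gives a `3 × 3` grid of short exact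
sequences with corners `U = F(X', Y')`, `R = F(X', Y)`, `S = F(X, Y')`, `D = F(X, Y)` and centre `Z`.
Let `Q` be the cokernel of `U ⟶ Z`, let `ζ` be the class of `U ⟶ Z ⟶ Q`, and let `i : R ⟶ Q` and
`k : S ⟶ Q` be the induced morphisms. The classes of the sequences that start at `U` are `i^* ζ` and
`k^* ζ`. If `ρ` and `σ` denote the classes of the sequences `R ⟶ ⬝ ⟶ D` and `S ⟶ ⬝ ⟶ D`, then
`i_* ρ + k_* σ = 0`: the pair `(ρ, σ)` is the class of the short exact sequence `R ⊞ S ⟶ Q ⟶ D`, and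
pushing a short exact sequence out along its own inflation splits it. This is
`ExactStructure.exists_corner_quotient`. A cup product that is additive in its second argument and
satisfies `(f^* d) ⌣ e = d ⌣ (f_* e)` therefore gives
`i^* ζ ⌣ ρ + k^* ζ ⌣ σ = ζ ⌣ (i_* ρ + k_* σ) = 0`, which is the required anticommutativity. All three
constructions of the second extensions have these two properties.
-/

namespace Extri

/-! ### Cup products -/

namespace ExtriangulatedStructure

variable {C : Type u} [Category.{v} C] [Preadditive C] [HasZeroObject C] [HasBinaryBiproducts C]
  {𝓒 : ExtriangulatedStructure.{w} C}

lemma cup_add {X Y Z : C} (d : 𝓒.E Y X) (e e' : 𝓒.E Z Y) :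
    𝓒.cup d (e + e') = 𝓒.cup d e + 𝓒.cup d e' := by
  unfold cup
  rw [TensorProduct.tmul_add, map_add]
  rfl

lemma cup_pull {X Y Y' Z : C} (f : Y ⟶ Y') (d : 𝓒.E Y' X) (e : 𝓒.E Z Y) :
    𝓒.cup (𝓒.pull f d) e = 𝓒.cup d (𝓒.push f e) := by
  unfold cup
  refine (QuotientAddGroup.eq_iff_sub_mem).2 (AddSubgroup.subset_closure ?_)
  exact ⟨Y, Y', f, d, e, rfl⟩

namespace Syzygies

variable (𝓢 : 𝓒.Syzygies)

lemma cup_add {X Y Z : C} (d : 𝓒.E Y X) (e e' : 𝓒.E Z Y) :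
    𝓢.cup d (e + e') = 𝓢.cup d e + 𝓢.cup d e' := by
  obtain ⟨a, rfl⟩ := 𝓢.exists_lift e
  obtain ⟨a', rfl⟩ := 𝓢.exists_lift e'
  rw [← 𝓒.push_add, cup_eq, cup_eq, cup_eq, 𝓒.pull_add]

lemma cup_pull {X Y Y' Z : C} (f : Y ⟶ Y') (d : 𝓒.E Y' X) (e : 𝓒.E Z Y) :
    𝓢.cup (𝓒.pull f d) e = 𝓢.cup d (𝓒.push f e) := by
  obtain ⟨a, rfl⟩ := 𝓢.exists_lift e
  rw [← 𝓒.push_comp, cup_eq, cup_eq, 𝓒.pull_comp]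

end Syzygies

namespace Cosyzygies

variable (𝓢 : 𝓒.Cosyzygies)

lemma cup_add {X Y Z : C} (d : 𝓒.E Y X) (e e' : 𝓒.E Z Y) :
    𝓢.cup d (e + e') = 𝓢.cup d e + 𝓢.cup d e' :=
  map_add _ _ _

lemma cup_pull {X Y Y' Z : C} (f : Y ⟶ Y') (d : 𝓒.E Y' X) (e : 𝓒.E Z Y) :
    𝓢.cup (𝓒.pull f d) e = 𝓢.cup d (𝓒.push f e) := by
  obtain ⟨c, rfl⟩ := 𝓢.exists_lift d
  rw [← 𝓒.pull_comp, cup_eq, cup_eq, 𝓒.push_comp]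

end Cosyzygies

/-- The anticommutativity of a product that is additive in its second argument and balanced, for
classes that arise from a common class `ζ` as in `ExactStructure.exists_corner_quotient`. -/
lemma eq_neg_of_push_add_push_eq_zero {X Z : C} {V : Type*} [AddCommGroup V]
    (c : ∀ Y, 𝓒.E Y X → 𝓒.E Z Y → V)
    (hadd : ∀ Y (d : 𝓒.E Y X) (e e' : 𝓒.E Z Y), c Y d (e + e') = c Y d e + c Y d e')
    (hpull : ∀ Y Y' (f : Y ⟶ Y') (d : 𝓒.E Y' X) (e : 𝓒.E Z Y),
      c Y (𝓒.pull f d) e = c Y' d (𝓒.push f e))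
    {Q R S : C} {ζ : 𝓒.E Q X} {i : R ⟶ Q} {k : S ⟶ Q} {d : 𝓒.E R X} {d' : 𝓒.E S X}
    {e : 𝓒.E Z R} {e' : 𝓒.E Z S} (hd : 𝓒.pull i ζ = d) (hd' : 𝓒.pull k ζ = d')
    (h : 𝓒.push i e + 𝓒.push k e' = 0) : c R d e = -c S d' e' := by
  have h0 : c Q ζ 0 = 0 := by simpa using hadd Q ζ 0 0
  rw [eq_neg_iff_add_eq_zero, ← hd, ← hd', hpull, hpull, ← hadd, h, h0]

end ExtriangulatedStructure

/-! ### Grids of short exact sequences -/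

namespace ExactStructure

variable {C : Type u} [Category.{v} C] [Preadditive C] [HasZeroObject C] [HasBinaryBiproducts C]
  {𝓔 : ExactStructure C}

/-- The push-out of a short exact sequence along its own inflation splits. -/
lemma Ext1.push_self {X W Y : C} {f : X ⟶ W} {g : W ⟶ Y} (h : 𝓔.IsConflation f g) :
    Ext1.push f (Ext1.mk h) = 0 :=
  Ext1.push_mk h _ _ (biprod.lift (𝟙 W) g) (by ext <;> simp [𝓔.comp_eq_zero h]) (by simp)

open Ext1 in
/-- In the commutative grid with rows `U ⟶ M ⟶ R`, `N ⟶ Z ⟶ P`, `S ⟶ T ⟶ D` and columns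
`U ⟶ N ⟶ S`, `M ⟶ Z ⟶ T`, `R ⟶ P ⟶ D`, whose rows and outer columns are short exact sequences and
whose middle column composes to zero, the two sequences that start at `U` are pull-backs of one
class `ζ` over the cokernel `Q` of `U ⟶ Z`, and the push-outs to `Q` of the two sequences that end
at `D` are opposite. -/
lemma exists_corner_quotient {U M R N Z P S T D : C} {f : U ⟶ M} {g : M ⟶ R} {a : U ⟶ N}
    {b : N ⟶ S} {m : N ⟶ Z} {n : Z ⟶ P} {p : R ⟶ P} {p' : P ⟶ D} {q : S ⟶ T} {q' : T ⟶ D}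
    {s : M ⟶ Z} {t : Z ⟶ T} (hf : 𝓔.IsConflation f g) (ha : 𝓔.IsConflation a b)
    (hm : 𝓔.IsConflation m n) (hp : 𝓔.IsConflation p p') (hq : 𝓔.IsConflation q q')
    (w₁ : f ≫ s = a ≫ m) (w₂ : s ≫ n = g ≫ p) (w₃ : m ≫ t = b ≫ q) (w₄ : n ≫ p' = t ≫ q')
    (w₅ : s ≫ t = 0) :
    ∃ (Q : C) (ζ : 𝓔.Ext1 Q U) (i : R ⟶ Q) (k : S ⟶ Q), pull i ζ = Ext1.mk hf ∧
      pull k ζ = Ext1.mk ha ∧ push i (Ext1.mk hp) + push k (Ext1.mk hq) = 0 := by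
  obtain ⟨Q, c, k, l, hc, hk, e₁, e₂, -, e₃, -⟩ := exists_et4 ha hm
  have := epi hf
  have := epi ha
  have := epi hc
  have := mono hp
  obtain ⟨i, hi⟩ := desc hf (s ≫ c) (by
    rw [reassoc_of% w₁, ← Category.assoc, 𝓔.comp_eq_zero hc])
  have hil : i ≫ l = p := by
    rw [← cancel_epi g, reassoc_of% hi, e₂, w₂]
  obtain ⟨r₂, hr₂⟩ := desc hc t (by
    rw [Category.assoc, w₃, reassoc_of% (𝓔.comp_eq_zero ha), zero_comp])
  have hkr : k ≫ r₂ = q := by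
    rw [← cancel_epi b, reassoc_of% e₁, hr₂, w₃]
  have hir : i ≫ r₂ = 0 := by
    rw [← cancel_epi g, reassoc_of% hi, hr₂, w₅, comp_zero]
  have hrl : r₂ ≫ q' = l ≫ p' := by
    rw [← cancel_epi c, reassoc_of% hr₂, reassoc_of% e₂, w₄]
  -- `G` is the kernel of `Q ⟶ D`; it is a direct sum of `R` and `S`, with inclusions `σ` and `k'`
  -- and projections `l'` and `r`.
  obtain ⟨G, j, k', l', hj, hk', e₄, e₅, -, e₆, -⟩ := exists_et4_op hk hp
  obtain ⟨σ, hσ⟩ := lift hj i (by rw [reassoc_of% hil, 𝓔.comp_eq_zero hp])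
  have hσl : σ ≫ l' = 𝟙 R := by
    rw [← cancel_mono p, Category.assoc, ← e₄, reassoc_of% hσ, hil, Category.id_comp]
  obtain ⟨r, hr⟩ := lift hk' (𝟙 G - l' ≫ σ) (by
    rw [Preadditive.sub_comp, Category.assoc, hσl]; simp)
  have hj' : l' ≫ i + r ≫ k = j := by
    rw [← e₅, reassoc_of% hr, Preadditive.sub_comp, Category.assoc, hσ]; simp
  have hrq : push r (Ext1.mk hj) = Ext1.mk hq := by
    refine push_mk hj hq r r₂ ?_ hrl
    rw [← hj', Preadditive.add_comp, Category.assoc, Category.assoc, hir, hkr, comp_zero, zero_add]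
  refine ⟨Q, Ext1.mk hc, i, k, pull_mk hc hf i s hi.symm w₁, e₃, ?_⟩
  rw [← e₆, ← hrq, ← push_comp, ← push_comp, ← push_hom_add, hj', push_self]

end ExactStructure

/-! ### Biexact and biextriangulated functors -/

section Functors

universe w₁ w₂ w₃

variable {A : Type u₁} [Category.{v₁} A] [Preadditive A] [HasZeroObject A] [HasBinaryBiproducts A]
  {B : Type u₂} [Category.{v₂} B] [Preadditive B] [HasZeroObject B] [HasBinaryBiproducts B]
  {C : Type u₃} [Category.{v₃} C] [Preadditive C] [HasZeroObject C] [HasBinaryBiproducts C]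

namespace ExtriangulatedFunctorStructure

lemma eq_of_β_eq {𝓐 : ExtriangulatedStructure.{w₁} A} {𝓑 : ExtriangulatedStructure.{w₂} B}
    {F : A ⥤ B} {S T : ExtriangulatedFunctorStructure 𝓐 𝓑 F}
    (h : ∀ Y X (d : 𝓐.E Y X), S.β Y X d = T.β Y X d) : S = T := by
  have e : S.β = T.β := by
    funext Y X
    exact AddMonoidHom.ext (h Y X)
  cases S
  cases T
  cases e
  rfl

variable {𝓔 : ExactStructure A} {𝓕 : ExactStructure B} {F : A ⥤ B}

/-- The functor underlying an extriangulated functor of exact categories is exact. -/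
lemma isExactFunctor (S : ExtriangulatedFunctorStructure 𝓔.extriangulated 𝓕.extriangulated F) :
    IsExactFunctor 𝓔 𝓕 F where
  map {_ _ _ f g} h :=
    (ExactStructure.Ext1.eq_mk_of_toSeqClass_eq
      (S.s_β (f := f) (g := g) (d := ExactStructure.Ext1.mk h) rfl)).choose

/-- A functor of exact categories has at most one structure of an extriangulated functor, because
the realisation of an exact category is injective. -/
instance : Subsingleton
    (ExtriangulatedFunctorStructure 𝓔.extriangulated 𝓕.extriangulated F) where
  allEq S T := by
    refine eq_of_β_eq fun Y X (d : 𝓔.Ext1 Y X) => ?_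
    induction d using ExactStructure.Ext1.ind with | @h W f g h
    obtain ⟨_, e⟩ := ExactStructure.Ext1.eq_mk_of_toSeqClass_eq
      (S.s_β (f := f) (g := g) (d := ExactStructure.Ext1.mk h) rfl)
    obtain ⟨_, e'⟩ := ExactStructure.Ext1.eq_mk_of_toSeqClass_eq
      (T.s_β (f := f) (g := g) (d := ExactStructure.Ext1.mk h) rfl)
    exact e.trans e'.symm

end ExtriangulatedFunctorStructure

variable {𝓔 : ExactStructure A} {𝓕 : ExactStructure B} {𝓖 : ExactStructure C}

lemma BiexactFunctor.toBiextriangulated_injective :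
    Function.Injective (fun F : BiexactFunctor 𝓔 𝓕 𝓖 => F.toBiextriangulated) := by
  intro F F' h
  have e : F.functor = F'.functor := congrArg BiextriangulatedFunctor.functor h
  cases F
  cases F'
  cases e
  rfl

lemma BiextriangulatedFunctor.exists_biexact
    (F : BiextriangulatedFunctor 𝓔.extriangulated 𝓕.extriangulated 𝓖.extriangulated) :
    ∃ F' : BiexactFunctor 𝓔 𝓕 𝓖, F'.toBiextriangulated = F := by
  obtain ⟨H, left, right, _, _⟩ := F
  refine ⟨⟨H, fun Y => (left Y).isExactFunctor, fun X => (right X).isExactFunctor⟩, ?_⟩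
  unfold BiexactFunctor.toBiextriangulated
  congr 1
  · exact Subsingleton.elim _ _
  · exact Subsingleton.elim _ _

open ExactStructure in
/-- `ExactStructure.exists_corner_quotient` for the grid that a biexact functor makes of two short
exact sequences. -/
lemma BiexactFunctor.exists_corner_quotient (F : BiexactFunctor 𝓔 𝓕 𝓖) {X X' : A} {Y Y' : B}
    (d : 𝓔.Ext1 X X') (e : 𝓕.Ext1 Y Y') :
    ∃ (Q : C) (ζ : 𝓖.extriangulated.E Q ((F.functor.obj X').obj Y'))
      (i : (F.functor.obj X').obj Y ⟶ Q) (k : (F.functor.obj X).obj Y' ⟶ Q),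
      𝓖.extriangulated.pull i ζ = F.toBiextriangulated.ψ X' e ∧
      𝓖.extriangulated.pull k ζ = F.toBiextriangulated.φ Y' d ∧
      𝓖.extriangulated.push i (F.toBiextriangulated.φ Y d) +
        𝓖.extriangulated.push k (F.toBiextriangulated.ψ X e) = 0 := by
  induction d using Ext1.ind with | @h W f g h
  induction e using Ext1.ind with | @h V f' g' h'
  refine ExactStructure.exists_corner_quotient ((F.right X').map h') ((F.left Y').map h)
    ((F.right W).map h') ((F.left Y).map h) ((F.right X).map h')
    (s := (F.functor.map f).app V) (t := (F.functor.map g).app V) ?_ ?_ ?_ ?_ ?_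
  · simp
  · simp
  · simp
  · simp
  · exact 𝓖.comp_eq_zero ((F.left V).map h)

theorem BiexactFunctor.isStrong (F : BiexactFunctor 𝓔 𝓕 𝓖)
    (T : 𝓖.extriangulated.HigherExtensions) : F.toBiextriangulated.IsStrong T := by
  cases T with
  | coend =>
    intro X X' Y Y' d e
    obtain ⟨Q, ζ, i, k, hi, hk, h⟩ := F.exists_corner_quotient d e
    exact ExtriangulatedStructure.eq_neg_of_push_add_push_eq_zero
      (fun Y => 𝓖.extriangulated.cup (Y := Y)) (fun _ => ExtriangulatedStructure.cup_add)
      (fun _ _ => ExtriangulatedStructure.cup_pull) hi hk h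
  | syzygy S =>
    intro X X' Y Y' d e
    obtain ⟨Q, ζ, i, k, hi, hk, h⟩ := F.exists_corner_quotient d e
    exact ExtriangulatedStructure.eq_neg_of_push_add_push_eq_zero
      (fun Y => S.cup (Y := Y)) (fun _ => S.cup_add) (fun _ _ => S.cup_pull) hi hk h
  | cosyzygy S =>
    intro X X' Y Y' d e
    obtain ⟨Q, ζ, i, k, hi, hk, h⟩ := F.exists_corner_quotient d e
    exact ExtriangulatedStructure.eq_neg_of_push_add_push_eq_zero
      (fun Y => S.cup (Y := Y)) (fun _ => S.cup_add) (fun _ _ => S.cup_pull) hi hk h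

end Functors

end Extri

theorem mainTheorem5
    {A : Type u₁} [Category.{v₁} A] [Preadditive A] [HasZeroObject A] [HasBinaryBiproducts A]
    {B : Type u₂} [Category.{v₂} B] [Preadditive B] [HasZeroObject B] [HasBinaryBiproducts B]
    {C : Type u₃} [Category.{v₃} C] [Preadditive C] [HasZeroObject C] [HasBinaryBiproducts C]
    (𝓔 : Extri.ExactStructure A) (𝓕 : Extri.ExactStructure B) (𝓖 : Extri.ExactStructure C)
    (T : 𝓖.extriangulated.HigherExtensions) :
    (∀ F : Extri.BiexactFunctor 𝓔 𝓕 𝓖, F.toBiextriangulated.IsStrong T) ∧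
    Set.BijOn (fun F : Extri.BiexactFunctor 𝓔 𝓕 𝓖 => F.toBiextriangulated) Set.univ
      {F | F.IsStrong T} :=
  ⟨fun F => F.isStrong T, fun F _ => F.isStrong T,
    Extri.BiexactFunctor.toBiextriangulated_injective.injOn, fun F _ => by
      obtain ⟨F', h⟩ := F.exists_biexact
      exact ⟨F', trivial, h⟩⟩
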